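/- **Conventions.** A *Hölder-like modulus* is a continuous, strictly increasing, subadditive $\omega:[0,\infty)\to[0,\infty)$ for which there is an increasing homeomorphism $h$ of $[0,\infty)$ with $\omega(st)\le h(s)\,\omega(t)$ for all $s,t\ge 0$; $f$ is *$\omega$-Hölder-like* if moreover $d(f(x),f(y))\le\omega(d(x,y))$ for all $x,y$. For increasing $\omega$, $\omega^\dagger(t)=\inf\{s:\omega(s)\ge t\}$; for decreasing $S$ on $[0,1]$, $S^\dagger(t)=\inf\{s\in[0,1]:S(s)\le t\}$. $C_A$ is the doubling constant of a metric space $A$ (least $C$ such that every ball of radius $2\rho$ is covered by $C$ balls of radius $\rho$). $\Delta_N$ is the standard simplex in $\mathbb R^N$ and $P_{\Delta_N}$ the Euclidean orthogonal projection onto it. $\mathcal P_1(\mathcal Z)$ is the set of Borel probability measures with finite first moment on the metric space $\mathcal Z$, with the Wasserstein distance $W_1$; $\mathcal Z$ is *barycentric* if $z\mapsto\delta_z$ has a $W_1$-uniformly continuous left inverse, and a *contracting barycenter map* is a $1$-Lipschitz left inverse of it. $A_R$ is the open $R$-neighbourhood of $A$ (with $\emptyset_R=\emptyset$), $A^c$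 the complement, and $d(x,\emptyset):=1$. **Source.** $(\mathcal X,d,\mu)$ is a metric space with a Borel probability measure carried by its compact support $K$. It has a *feature decomposition* $\{(\mathcal X_n,\phi_n)\}_{n\le N}$, $N\in\mathbb N\cup\{\infty\}$: non-empty closed $\mathcal X_n\subseteq\mathcal X$ and continuous injective $\phi_n:\mathcal X_n\to F_n$ into Banach spaces with the bounded approximation property (BAP) such that (i) $\partial\mathcal X_n:=\mathcal X_n\cap\bigcup_{m\ne n}\mathcal X_m$ is $\mu$-null; (ii) $\mathcal X=\bigcup_n\mathcal X_n$ if $N<\infty$; if $N=\infty$, then $\bigcup_n\mathcal X_n$ has full measure, the topological boundary of each $\mathcal X_n$ is $\mu$-null, and $\mu(\bigcup_{m>n}\mathcal X_m)\le C_\mu n^{-r}$ for all $n\geq 1$, for some $C_\mu,r>0$; (iii) for some $C>0$ and $r_n>0$, $\mu((\partial\mathcal X_n)_R\cap\mathcal X_n)\le C\mu(\mathcal X_n)R^{r_n}$ for all $n$ and $0\le R\le\operatorname{diam}\mathcal X_n$; (iv) $\inf_n\operatorname{diam}\mathcal X_n>0$. Put $K_n=K\cap\mathcal X_n$. Each $(\phi_n|_{K_n})^{-1}$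 has a Hölder-like modulus $\omega_{\phi_n}$; put $\Omega_n=\omega\circ\omega_{\phi_n}$. Either every $\phi_n$ is quasisymmetric and every $K_n$ is doubling, or every $\phi_n(K_n)$ is doubling. For each $n$, the finite-rank operators $(T^{(n)}_k)_k$ of rank $d_{n,k}\ge1$ on $F_n$ realize the BAP on $\phi_n(K_n)$: they are uniformly bounded and $T^{(n)}_ku\to u$ uniformly on $\phi_n(K_n)$. Let $R_n(\epsilon)$ be the first index $k$ with $\|T^{(n)}_ku-u\|\le\epsilon$ on $\phi_n(K_n)$. Let $\iota_{n,k}:\mathbb R^{d_{n,k}}\to T_k^{(n)}(F_n)$ be linear isomorphisms, and $\phi_{n,k}=\iota_{n,k}^{-1}\circ T^{(n)}_k\circ\phi_n$. **Target.** $\mathcal Y$ is a separable metric space with a QAS structure: a *mixing function* $\eta:\bigcup_{N\geq 1}\Delta_N\times\mathcal Y^N\to\mathcal Y$ with constants $C_\eta\ge1$, $p\in\mathbb N_+$ such that $d(\eta(w,\mathbf y),y_i)\le C_\eta(\sum_jd(y_i,y_j)^pw_j)^{1/p}$ for all $i$, and a *quantization* $Q_q:\mathbb R^{D_q}\to\mathcal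 Y$ ($D_q\geq 1$) with images increasing in $q$ and dense union, such that for each compact $A$ and $\epsilon>0$ there is $q$ with $A$ in the $\epsilon$-neighbourhood of the image of $Q_q$. Put $\hat\eta(w,Z)=\eta(w,(Q_q(Z_i))_i)$ and, for $A\subseteq V\subseteq\mathcal Y$, $$\mathscr Q^V_A(\epsilon)=\min\{D_q:\ \forall y\in A\ \exists z\in\mathbb R^{D_q}\ \text{with}\ Q_q(z)\in V,\ d(y,Q_q(z))<\epsilon\}.$$ For $(A,\bar y)$ with $\bar y\in A$ put $A^\delta=\{\eta((1-\delta,\delta),(\bar y,a)):a\in A\}$. $\mathcal Y$ has a *quantized geodesic partition* $\{(\mathcal Y_m,\bar y_m)\}_{m\le M}$: closed sets covering $\mathcal Y$, with $\bar y_m\in\mathcal Y_m$, closed under $\eta$, each barycentric, with $\mathcal Y_m^\delta\cap\mathcal Y_{m'}=\emptyset$ for $m\ne m'$, $0\le\delta<1$; and a continuous strictly decreasing $S:[0,1]\to[0,\infty)$ with $S(1)=0$, $S(0)=\min_{m\ne m'}d(\bar y_m,\bar y_{m'})$ (if $M\ge2$), and Hausdorff distance $d_{\mathbb H}(\mathcal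 Y_m^\delta,\mathcal Y_{m'}^\delta)\ge S(\delta)$ for $m\ne m'$, $\delta\in[0,1]$. The partition has a *uniform gap* if moreover $d(y,y')\ge S(\delta)$ for all $y\in\mathcal Y_m^\delta$, $y'\in\mathcal Y_{m'}^\delta$, $m\ne m'$, $\delta\in[0,1]$. **Approximator.** $\mathcal F_\cdot$ is a *universal approximator*: for each $n,m\ge1$ a family $\mathcal F_{n,m,c}$, $c\geq 1$, of maps $\mathbb R^n\to\mathbb R^m$, nested in $c$, and a rate $r_{\mathcal F}(\omega,A,n,m,c)\ge 0$, non-increasing in $c$ with limit $0$, such that every $f:\mathbb R^n\to\mathbb R^m$ with continuous modulus of continuity $\omega$ is approximated uniformly on each non-empty compact $A$ up to $r_{\mathcal F}(\omega,A,n,m,c)$ by an element of $\mathcal F_{n,m,c}$, for every $c$. Put $r_{\mathcal F}^\dagger(\omega,A,n,m,s)=\min\{c\ge1:r_{\mathcal F}(\omega,A,n,m,c)\le s\}$. **Map.** $f:\mathcal X\to\mathcal Y$ is $\omega$-Hölder-like and *geometrically stable*: there are $C_f,q_1,\dots,q_M>0$ with $\mu(f^{-1}(\mathcal Y_m\setminus\mathcal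 Y_m^\delta))\le C_f(1-\delta)^{q_m}\mu(f^{-1}(\mathcal Y_m))$ for $\delta\in[0,1)$ (outer measure if needed). **Theorem.** There are positive constants $C^d_n,C^N_n,C^{(2)}_{n,k},C^{(3)}_{n,k},A_{n,k},C^s_{n,k}$, depending only on $\mu$, the feature decomposition, the moduli $\omega,\omega_{\phi_n}$, the operators $T^{(n)}_k$ with their coordinates $\iota_{n,k}$, and the QAS structure, and positive constants $C_0,C_1,C_2$ independent of $\delta,\epsilon_A,\epsilon_Q,\epsilon_E$, such that the following holds. For all $\epsilon_A>0$ and $\delta\in(0,1]$ there are $0<\epsilon_\star\le\min\{\epsilon_A,\inf_n\operatorname{diam}\mathcal X_n,\tfrac12\}$, $N^\star\in\mathbb N_+$ with $N^\star\le N$, a resolution $0<\sigma\le\min\{\epsilon_A,\frac12\}$, with $\sigma=\epsilon_\star$ if the partition has a uniform gap, and a Borel set $\mathcal X_{\epsilon_\star}$ such that, with $\delta_\star=S^\dagger(3\epsilon_\star)$, $$\mu(\mathcal X_{\epsilon_\star})\ \ge\ 1-C_0\sum_{m\le M}(1-\delta_\star)^{q_m}f_\#\mu(\mathcal Y_m)-C_1(N^\star)^{-r}-\sum_{n\le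 N^\star}C_2\,\mu(\mathcal X_n)\,\epsilon_\star^{r_n}\ \ge\ 1-\delta,$$ where the term $C_1(N^\star)^{-r}$ is absent if $N^\star=N$; and for all $\epsilon_Q,\epsilon_E>0$ there is a map $\hat T:\mathcal X\to\mathcal P_1(\mathcal Y)$ with $$\sup_{x\in\mathcal X_{\epsilon_\star}}W_1(\hat T(x),\delta_{f(x)})<\epsilon_A+\epsilon_Q+\epsilon_E$$ and, for all $x\in\mathcal X_{\epsilon_\star}$, $$\hat T(x)=\sum_{n\le N^\star}\sum_{m\le M}[C^{\mathcal X}(x)]_n\,[C^{\mathcal Y}(x)]_m\,\delta_{f^{(n,m)}(x)},$$ where $$[C^{\mathcal X}(x)]_n=\frac{d(x,\mathcal X_n^c)}{\sum_{i\le N^\star}d(x,\mathcal X_i^c)},\qquad [C^{\mathcal Y}(x)]_m=\frac{I(\hat C_m(x)\le\epsilon_A/4)}{\sum_{m'\le M}I(\hat C_{m'}(x)\le\epsilon_A/4)},$$ $$\hat C_m(x)=\sum_{n\le N^\star}[C^{\mathcal X}(x)]_n\sum_{i\le\tilde N}\big[P_{\Delta_{\tilde N}}(g(\phi_{n,\tilde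 k}(x)))\big]_i|z_i|,\qquad f^{(n,m)}(x)=\hat\eta\big(P_{\Delta_{N'}}(\hat f(\phi_{n,k}(x))),Z\big).$$ Here, for each $(n,m)$ (indices $(n,m)$ on the parameters suppressed), $\hat f\in\mathcal F_{d_{n,k},N',c}$ and $g\in\mathcal F_{d_{n,\tilde k},\tilde N,\tilde c}$ with $N',c,\tilde N,\tilde c\geq 1$, $Z\in\mathbb R^{N'\times D_q}$ and $z\in\mathbb R^{\tilde N}$. Whenever $K_n\neq\emptyset$, one has $D_q=\mathscr Q^{\mathcal Y_m}_{f(K_n)\cap\mathcal Y_m}\big(\epsilon_Q/(4C_\eta)\big)$ and $$k\le R_n\Big(\omega_{\phi_n}^\dagger\big(\omega^\dagger(\epsilon_E/C^d_n)\big)\Big),\qquad \ln N'\le C^N_n\,\ln\big(C_{T^{(n)}_k\phi_n(K_n)}\big)\Big\lceil-\log_2\big(C^{(2)}_{n,k}\,\Omega_n^\dagger(C^{(3)}_{n,k}\epsilon_Q)\big)\Big\rceil_+,$$ $$c\le r_{\mathcal F}^\dagger\Big(\tfrac{A_{n,k}}{\epsilon_A}\Omega_n,\ \phi_{n,k}(K_n),\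 d_{n,k},\ N',\ C^s_{n,k}\,\epsilon_A^{p}\,(N')^{-1/2}\Big),$$ where $\lceil t\rceil_+=\max\{0,\lceil t\rceil\}$; and $\tilde k,\tilde N,\tilde c$ satisfy the same three bounds with $\epsilon_E,\epsilon_Q,\epsilon_A$ all replaced by $\sigma$ and $p$ by $1$. Finally, for every $x\in\mathcal X_{\epsilon_\star}$ there is $m\le M$ such that $[C^{\mathcal Y}(x)]_m=1$, $\hat T(x)$ is (the push-forward of) an element of $\mathcal P_1(\mathcal Y_m)$, so that $\beta(\hat T(x))$ is well-defined for any contracting barycenter map $\beta:\mathcal P_1(\mathcal Y_m)\to\mathcal Y_m$, and $d(\beta(\hat T(x)),f(x))<\epsilon_A+\epsilon_Q+\epsilon_E$ for every such $\beta$. -/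

import Mathlib

open MeasureTheory Set Filter Topology
open scoped NNReal ENNReal

noncomputable section

/-! ### Moduli, doubling sets, quasisymmetric maps -/

/-- The Euclidean space `ℝⁿ`. -/
abbrev Euc (n : ℕ) : Type := EuclideanSpace ℝ (Fin n)

/-- Generalized inverse `ω†(t) = inf {s : ω s ≥ t}` of an increasing function on `[0,∞)`. -/
def genInv (ω : ℝ≥0 → ℝ≥0) (t : ℝ≥0) : ℝ≥0 := sInf {s | t ≤ ω s}

/-- Generalized inverse `S†(t) = inf {s ∈ [0,1] : S s ≤ t}` of a decreasing function on `[0,1]`. -/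
def decInv (S : ℝ → ℝ) (t : ℝ) : ℝ := sInf {s | s ∈ Icc (0 : ℝ) 1 ∧ S s ≤ t}

/-- Hölder-like moduli of continuity: continuous, strictly increasing, subadditive, and
`ω (s t) ≤ h s · ω t` for an increasing homeomorphism `h` of `[0,∞)`. -/
structure IsHolderLikeModulus (ω : ℝ≥0 → ℝ≥0) : Prop where
  continuous : Continuous ω
  strictMono : StrictMono ω
  subadditive : ∀ s t, ω (s + t) ≤ ω s + ω t
  scaling : ∃ h : ℝ≥0 ≃o ℝ≥0, ∀ s t, ω (s * t) ≤ h s * ω t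

/-- `f` is `ω`-Hölder-like. -/
def IsHolderLike {X Y : Type*} [PseudoMetricSpace X] [PseudoMetricSpace Y]
    (ω : ℝ≥0 → ℝ≥0) (f : X → Y) : Prop :=
  IsHolderLikeModulus ω ∧ ∀ x y, nndist (f x) (f y) ≤ ω (nndist x y)

/-- The subset `s`, as a metric space, has the doubling property with constant `C`: every ball of
radius `2r` of `s` is covered by `C` balls of radius `r` of `s`. -/
def IsDoublingWith {Z : Type*} [PseudoMetricSpace Z] (s : Set Z) (C : ℕ) : Prop :=
  ∀ x ∈ s, ∀ r : ℝ, 0 < r → ∃ t : Finset Z, (t : Set Z) ⊆ s ∧ t.card ≤ C ∧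
    Metric.ball x (2 * r) ∩ s ⊆ ⋃ y ∈ t, Metric.ball y r

def IsDoubling {Z : Type*} [PseudoMetricSpace Z] (s : Set Z) : Prop :=
  ∃ C, IsDoublingWith s C

/-- The doubling constant: the smallest admissible number of balls. -/
def doublingConst {Z : Type*} [PseudoMetricSpace Z] (s : Set Z) : ℕ :=
  sInf {C | IsDoublingWith s C}

/-- `φ` restricted to `s` is a quasisymmetric embedding. -/
def IsQuasisymmetricOn {X F : Type*} [PseudoMetricSpace X] [PseudoMetricSpace F]
    (φ : X → F) (s : Set X) : Prop :=
  IsEmbedding (fun x : s => φ x) ∧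
    ∃ h : ℝ≥0 ≃o ℝ≥0, ∀ x₁ ∈ s, ∀ x₂ ∈ s, ∀ x₃ ∈ s, ∀ t : ℝ≥0,
      nndist x₁ x₂ ≤ t * nndist x₁ x₃ → nndist (φ x₁) (φ x₂) ≤ h t * nndist (φ x₁) (φ x₃)

/-! ### The bounded approximation property -/

/-- The finite-rank operators `T k` realize the `C`-bounded approximation property on `s`. -/
def RealizesBAP {F : Type*} [NormedAddCommGroup F] [NormedSpace ℝ F]
    (T : ℕ → F →L[ℝ] F) (s : Set F) (C : ℝ) : Prop :=
  (∀ k, FiniteDimensional ℝ (LinearMap.range (T k : F →ₗ[ℝ] F))) ∧ (∀ k, ‖T k‖ ≤ C) ∧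
    TendstoUniformlyOn (fun k u => T k u) id atTop s

/-- `F` has the bounded approximation property. -/
def HasBAP (F : Type*) [NormedAddCommGroup F] [NormedSpace ℝ F] : Prop :=
  ∃ C : ℝ, 0 < C ∧ ∀ s : Set F, s.Nonempty → IsCompact s →
    ∃ T : ℕ → F →L[ℝ] F, RealizesBAP T s C

/-- The rate of approximation of the identity: the first index `k` for which
`‖T k u - u‖ ≤ ε` on all of `s`. -/
def bapIndex {F : Type*} [NormedAddCommGroup F] [NormedSpace ℝ F]
    (T : ℕ → F →L[ℝ] F) (s : Set F) (ε : ℝ≥0) : ℕ :=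
  sInf {k | ∀ u ∈ s, ‖T k u - u‖ ≤ ε}

/-! ### Feature decompositions -/

/-- A feature decomposition of `(X, μ)` into parts `part n`, for `n < N` with `N ∈ ℕ ∪ {∞}`,
with feature maps `φ n` (used on `part n` only) into Banach spaces `F n`.
Parts are numbered from `0`, so that the parts of index `≥ n` are all but the first `n`. -/
structure FeatureDecomposition (X : Type*) [MetricSpace X] [MeasurableSpace X]
    (μ : Measure X) where
  N : ℕ∞
  part : ℕ → Set X
  F : ℕ → Type*
  [normedGroup : ∀ n, NormedAddCommGroup (F n)]
  [normedSpace : ∀ n, NormedSpace ℝ (F n)]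
  [complete : ∀ n, CompleteSpace (F n)]
  φ : ∀ n, X → F n
  /-- decay exponent of the tail -/
  r : ℝ
  /-- boundary exponents of the parts -/
  ρ : ℕ → ℝ
  r_pos : 0 < r
  ρ_pos : ∀ n : ℕ, (n : ℕ∞) < N → 0 < ρ n
  nonempty : ∀ n : ℕ, (n : ℕ∞) < N → (part n).Nonempty
  isClosed : ∀ n : ℕ, (n : ℕ∞) < N → IsClosed (part n)
  continuousOn : ∀ n : ℕ, (n : ℕ∞) < N → ContinuousOn (φ n) (part n)
  injOn : ∀ n : ℕ, (n : ℕ∞) < N → InjOn (φ n) (part n)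
  hasBAP : ∀ n : ℕ, (n : ℕ∞) < N → HasBAP (F n)
  /-- almost disjointness: the overlap of a part with the other parts is a null set -/
  overlap_null : ∀ n : ℕ, (n : ℕ∞) < N →
    μ (part n ∩ ⋃ m : ℕ, ⋃ _ : m ≠ n ∧ (m : ℕ∞) < N, part m) = 0
  /-- a finite family covers `X` -/
  cover : N ≠ ⊤ → ⋃ n : ℕ, ⋃ _ : (n : ℕ∞) < N, part n = univ
  /-- an infinite family covers almost all of `X`, with a polynomially decaying tail -/
  cover_ae : N = ⊤ → μ (⋃ n : ℕ, part n)ᶜ = 0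
  tail : N = ⊤ → ∃ C : ℝ, 0 < C ∧ ∀ n : ℕ, 1 ≤ n →
    μ.real (⋃ m : ℕ, ⋃ _ : n ≤ m, part m) ≤ C * (n : ℝ) ^ (-r)
  /-- topological boundaries of the parts of an infinite family are null sets (for a finite family
  this follows from `cover` and `overlap_null`) -/
  frontier_null : N = ⊤ → ∀ n : ℕ, μ (frontier (part n)) = 0
  /-- Ahlfors regularity near the overlaps -/
  ahlfors : ∃ C : ℝ, 0 < C ∧ ∀ n : ℕ, (n : ℕ∞) < N → ∀ R : ℝ, 0 ≤ R →
    ENNReal.ofReal R ≤ Metric.ediam (part n) →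
    μ.real (Metric.thickening R
        (part n ∩ ⋃ m : ℕ, ⋃ _ : m ≠ n ∧ (m : ℕ∞) < N, part m) ∩ part n)
      ≤ C * μ.real (part n) * R ^ ρ n
  /-- diameters do not collapse -/
  diam_pos : 0 < ⨅ n : ℕ, ⨅ _ : (n : ℕ∞) < N, Metric.ediam (part n)

attribute [instance] FeatureDecomposition.normedGroup FeatureDecomposition.normedSpace
  FeatureDecomposition.complete

namespace FeatureDecomposition

variable {X : Type*} [MetricSpace X] [MeasurableSpace X] {μ : Measure X}

/-- The part of the support of `μ` that lies in `part n`. -/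
def core (D : FeatureDecomposition X μ) (n : ℕ) : Set X := D.part n ∩ μ.support

/-- The image of `core n` in feature space. -/
def feat (D : FeatureDecomposition X μ) (n : ℕ) : Set (D.F n) := D.φ n '' D.core n

/-- The infimum of the diameters of the parts. -/
def infDiam (D : FeatureDecomposition X μ) : ℝ≥0∞ :=
  ⨅ n : ℕ, ⨅ _ : (n : ℕ∞) < D.N, Metric.ediam (D.part n)

end FeatureDecomposition

/-- Finite-rank operators `T n k` on the feature spaces which realize the bounded approximation
property on the images of the support of `μ`, with linear coordinates on their ranges: `ι n k`
is the linear map sending the standard basis of `ℝ^(dim n k)` to a basis of the range of `T n k`. -/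
structure BAPEncoding {X : Type*} [MetricSpace X] [MeasurableSpace X] {μ : Measure X}
    (D : FeatureDecomposition X μ) where
  T : ∀ n, ℕ → D.F n →L[ℝ] D.F n
  dim : ℕ → ℕ → ℕ
  dim_pos : ∀ n k : ℕ, (n : ℕ∞) < D.N → 0 < dim n k
  ι : ∀ n k, Euc (dim n k) ≃ₗ[ℝ] LinearMap.range (T n k : D.F n →ₗ[ℝ] D.F n)
  realizes : ∀ n : ℕ, (n : ℕ∞) < D.N → ∃ C : ℝ, 0 < C ∧ RealizesBAP (T n) (D.feat n) C

/-- The approximate feature map `ι⁻¹ ∘ T ∘ φ`. -/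
def BAPEncoding.encode {X : Type*} [MetricSpace X] [MeasurableSpace X] {μ : Measure X}
    {D : FeatureDecomposition X μ} (enc : BAPEncoding D) (n k : ℕ) (x : X) :
    Euc (enc.dim n k) :=
  (enc.ι n k).symm ⟨enc.T n k (D.φ n x), D.φ n x, rfl⟩

/-! ### Quantizable and approximately simplicial spaces -/

/-- A QAS structure on `Y`: a mixing function `eta` (with constant `Cη` and exponent `p`) and
a quantization `Q`. -/
structure QAS (Y : Type*) [MetricSpace Y] where
  eta : ∀ N : ℕ, (Fin N → ℝ) → (Fin N → Y) → Y
  Cη : ℝ≥0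
  p : ℕ
  one_le_Cη : 1 ≤ Cη
  one_le_p : 1 ≤ p
  mixing : ∀ (N : ℕ), ∀ w ∈ stdSimplex ℝ (Fin N), ∀ (y : Fin N → Y) (i : Fin N),
    dist (eta N w y) (y i) ≤ Cη * (∑ j, dist (y i) (y j) ^ p * w j) ^ (1 / (p : ℝ))
  D : ℕ → ℕ
  one_le_D : ∀ q, 1 ≤ D q
  Q : ∀ q, (Fin (D q) → ℝ) → Y
  nested : ∀ q z, ∃ z', Q q z = Q (q + 1) z'
  dense : ∀ y : Y, ∀ ε : ℝ, 0 < ε → ∃ q z, dist y (Q q z) < ε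
  quantizes : ∀ A : Set Y, IsCompact A → ∀ ε : ℝ, 0 < ε →
    ∃ q, ∀ y ∈ A, ∃ z, dist y (Q q z) < ε

namespace QAS

variable {Y : Type*} [MetricSpace Y]

/-- The quantized mixing map. -/
def etaHat (𝒜 : QAS Y) (N q : ℕ) (w : Fin N → ℝ) (Z : Fin N → Fin (𝒜.D q) → ℝ) : Y :=
  𝒜.eta N w fun i => 𝒜.Q q (Z i)

/-- The quantization modulus of `A` inside `V`: the least dimension `D q` such that every point
of `A` is within `ε` of a point of `V` of the form `Q q z`. -/
def quantModulus (𝒜 : QAS Y) (V A : Set Y) (ε : ℝ) : ℕ :=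
  sInf {d | ∃ q, 𝒜.D q = d ∧ ∀ y ∈ A, ∃ z, 𝒜.Q q z ∈ V ∧ dist y (𝒜.Q q z) < ε}

/-- The contraction `A^δ` of `A` towards the point `b`. -/
def retract (𝒜 : QAS Y) (A : Set Y) (b : Y) (δ : ℝ) : Set Y :=
  {y | ∃ a ∈ A, y = 𝒜.eta 2 ![1 - δ, δ] ![b, a]}

/-- `η`-convexity. -/
def IsEtaConvex (𝒜 : QAS Y) (A : Set Y) : Prop :=
  ∀ k : ℕ, 1 ≤ k → ∀ w ∈ stdSimplex ℝ (Fin k), ∀ y : Fin k → Y,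
    (∀ i, y i ∈ A) → 𝒜.eta k w y ∈ A

end QAS

/-! ### Wasserstein space and barycenters -/

/-- Borel probability measures with finite first moment. -/
def P1 (Z : Type*) [MetricSpace Z] [MeasurableSpace Z] : Type _ :=
  {ν : Measure Z // IsProbabilityMeasure ν ∧ ∃ z₀ : Z, ∫⁻ z, edist z z₀ ∂ν ≠ ∞}

/-- Point masses. -/
def diracP1 {Z : Type*} [MetricSpace Z] [MeasurableSpace Z] [BorelSpace Z] (z : Z) : P1 Z :=
  ⟨Measure.dirac z, inferInstance, z, by simp⟩

/-- The `1`-Wasserstein distance. -/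
def W1 {Z : Type*} [MetricSpace Z] [MeasurableSpace Z] (ν₁ ν₂ : P1 Z) : ℝ≥0∞ :=
  ⨅ π : Measure (Z × Z), ⨅ _ : π.map Prod.fst = ν₁.1 ∧ π.map Prod.snd = ν₂.1,
    ∫⁻ z, edist z.1 z.2 ∂π

/-- A barycentric space: `z ↦ δ_z` has a left inverse which is uniformly continuous for `W₁`. -/
def IsBarycentric (Z : Type*) [MetricSpace Z] [MeasurableSpace Z] [BorelSpace Z] : Prop :=
  ∃ β : P1 Z → Z, (∀ z, β (diracP1 z) = z) ∧
    ∀ ε : ℝ, 0 < ε → ∃ δ : ℝ, 0 < δ ∧ ∀ ν₁ ν₂,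
      W1 ν₁ ν₂ < ENNReal.ofReal δ → dist (β ν₁) (β ν₂) < ε

/-- A contracting barycenter map: a `1`-Lipschitz left inverse of `z ↦ δ_z`. -/
def IsContractingBarycenter {Z : Type*} [MetricSpace Z] [MeasurableSpace Z] [BorelSpace Z]
    (β : P1 Z → Z) : Prop :=
  (∀ z, β (diracP1 z) = z) ∧ ∀ ν₁ ν₂, edist (β ν₁) (β ν₂) ≤ W1 ν₁ ν₂

/-! ### Quantized geodesic partitions and geometrically stable maps -/

/-- A quantized geodesic partition of `Y` into pointed parts `(part m, base m)`, with
separation rate `S`. -/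
structure IsQuantizedGeodesicPartition {Y : Type*} [MetricSpace Y] [MeasurableSpace Y]
    [BorelSpace Y] (𝒜 : QAS Y) {M : ℕ} (part : Fin M → Set Y) (base : Fin M → Y)
    (S : ℝ → ℝ) : Prop where
  isClosed : ∀ m, IsClosed (part m)
  base_mem : ∀ m, base m ∈ part m
  etaConvex : ∀ m, 𝒜.IsEtaConvex (part m)
  disjoint : ∀ m m', m ≠ m' → ∀ δ : ℝ, 0 ≤ δ → δ < 1 →
    𝒜.retract (part m) (base m) δ ∩ part m' = ∅
  cover : ⋃ m, part m = univ
  barycentric : ∀ m, IsBarycentric (part m)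
  S_continuous : ContinuousOn S (Icc 0 1)
  S_anti : StrictAntiOn S (Icc 0 1)
  S_one : S 1 = 0
  /-- `S 0` is the least distance between distinct base points (void for a single part) -/
  S_zero : 2 ≤ M → IsLeast {t | ∃ m m', m ≠ m' ∧ t = dist (base m) (base m')} (S 0)
  separation : ∀ m m', m ≠ m' → ∀ δ ∈ Icc (0 : ℝ) 1,
    ENNReal.ofReal (S δ) ≤ Metric.hausdorffEDist
      (𝒜.retract (part m) (base m) δ) (𝒜.retract (part m') (base m') δ)

/-- The pointwise strengthening of the separation condition: points of distinct contracted parts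
have distance at least `S δ`. -/
def HasUniformGap {Y : Type*} [MetricSpace Y] (𝒜 : QAS Y) {M : ℕ} (part : Fin M → Set Y)
    (base : Fin M → Y) (S : ℝ → ℝ) : Prop :=
  ∀ m m', m ≠ m' → ∀ δ ∈ Icc (0 : ℝ) 1, ∀ y ∈ 𝒜.retract (part m) (base m) δ,
    ∀ y' ∈ 𝒜.retract (part m') (base m') δ, S δ ≤ dist y y'

/-- `f` is geometrically stable, with exponents `q`. -/
def IsGeometricallyStable {X Y : Type*} [MeasurableSpace X] [MetricSpace Y] (μ : Measure X)
    (𝒜 : QAS Y) {M : ℕ} (part : Fin M → Set Y) (base : Fin M → Y) (f : X → Y)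
    (q : Fin M → ℝ) : Prop :=
  (∀ m, 0 < q m) ∧ ∃ C : ℝ, 0 < C ∧ ∀ m, ∀ δ : ℝ, 0 ≤ δ → δ < 1 →
    μ.real (f ⁻¹' (part m \ 𝒜.retract (part m) (base m) δ))
      ≤ C * (1 - δ) ^ q m * μ.real (f ⁻¹' part m)

/-! ### Universal approximators -/

/-- A universal approximator: nested families `fam n m c` of maps `ℝⁿ → ℝᵐ`, with rate
function `rate ω n s m c`, where `s ⊆ ℝⁿ` is compact. -/
structure UniversalApproximator where
  fam : ∀ n m : ℕ, ℕ → Set (Euc n → Euc m)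
  rate : (ℝ≥0 → ℝ≥0) → ∀ n : ℕ, Set (Euc n) → ℕ → ℕ → ℝ≥0
  nested : ∀ n m c : ℕ, 1 ≤ n → 1 ≤ m → 1 ≤ c → fam n m c ⊆ fam n m (c + 1)
  approx : ∀ n m : ℕ, 1 ≤ n → 1 ≤ m → ∀ (f : Euc n → Euc m) (ω : ℝ≥0 → ℝ≥0),
    Continuous ω → Monotone ω → ω 0 = 0 → (∀ x y, nndist (f x) (f y) ≤ ω (nndist x y)) →
    ∀ s : Set (Euc n), s.Nonempty → IsCompact s → ∀ c : ℕ, 1 ≤ c →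
      ∃ g ∈ fam n m c, ∀ x ∈ s, ‖f x - g x‖ ≤ rate ω n s m c
  rate_anti : ∀ n m : ℕ, 1 ≤ n → 1 ≤ m → ∀ ω : ℝ≥0 → ℝ≥0,
    Continuous ω → Monotone ω → ω 0 = 0 → ∀ s : Set (Euc n), s.Nonempty → IsCompact s →
      AntitoneOn (rate ω n s m) (Ici 1)
  rate_tendsto : ∀ n m : ℕ, 1 ≤ n → 1 ≤ m → ∀ ω : ℝ≥0 → ℝ≥0,
    Continuous ω → Monotone ω → ω 0 = 0 → ∀ s : Set (Euc n), s.Nonempty → IsCompact s →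
      Tendsto (rate ω n s m) atTop (𝓝 0)

/-- Generalized inverse of the rate in the complexity `c ≥ 1`: the least `c` with rate at most `t`. -/
def UniversalApproximator.rateInv (𝓕 : UniversalApproximator) (ω : ℝ≥0 → ℝ≥0) (n : ℕ)
    (s : Set (Euc n)) (m : ℕ) (t : ℝ≥0) : ℕ :=
  sInf {c | 1 ≤ c ∧ 𝓕.rate ω n s m c ≤ t}

/-! ### The model -/

/-- The Euclidean orthogonal projection of `ℝᴺ` onto the standard simplex (`N ≥ 1`). -/
def simplexProj {N : ℕ} (v : Euc N) : Fin N → ℝ :=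
  Classical.epsilon fun w : Fin N → ℝ => w ∈ stdSimplex ℝ (Fin N) ∧
    ∀ w' ∈ stdSimplex ℝ (Fin N), dist v (WithLp.toLp 2 w) ≤ dist v (WithLp.toLp 2 w')

/-- The distance to the complement of `A`, with value `1` if the complement is empty. -/
def complDist {X : Type*} [MetricSpace X] (A : Set X) (x : X) : ℝ :=
  open scoped Classical in if A = univ then 1 else Metric.infDist x Aᶜ

section Model

variable {X : Type*} [MetricSpace X] [MeasurableSpace X] {μ : Measure X}
  {D : FeatureDecomposition X μ} {Y : Type*} [MetricSpace Y]

/-- The weight `[C^X(x)]_n` in the partition of `X` built from the first `L` parts. -/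
def weightX (D : FeatureDecomposition X μ) (L n : ℕ) (x : X) : ℝ :=
  complDist (D.part n) x / ∑ i ∈ Finset.range L, complDist (D.part i) x

/-- The parameters of the model, for the part `n` of `X` and the part `m` of `Y`: encoding
indices `k`, `k'`, numbers of weights `N`, `N'`, complexities `c`, `c'`, quantization level `q`,
quantized points `Z`, `z`, and Euclidean maps `fhat`, `g`. The primed data define the
approximate partition of `Y`. -/
structure ModelParams (enc : BAPEncoding D) (𝒜 : QAS Y) (M : ℕ) where
  k : ℕ → Fin M → ℕ
  N : ℕ → Fin M → ℕ
  c : ℕ → Fin M → ℕ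
  q : ℕ → Fin M → ℕ
  Z : ∀ n m, Fin (N n m) → Fin (𝒜.D (q n m)) → ℝ
  fhat : ∀ n m, Euc (enc.dim n (k n m)) → Euc (N n m)
  k' : ℕ → Fin M → ℕ
  N' : ℕ → Fin M → ℕ
  c' : ℕ → Fin M → ℕ
  z : ∀ n m, Fin (N' n m) → ℝ
  g : ∀ n m, Euc (enc.dim n (k' n m)) → Euc (N' n m)

namespace ModelParams

variable {enc : BAPEncoding D} {𝒜 : QAS Y} {M : ℕ}

/-- The approximation `f^{(n,m)}` of the target function. -/
def localMap (P : ModelParams enc 𝒜 M) (n : ℕ) (m : Fin M) (x : X) : Y :=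
  𝒜.etaHat (P.N n m) (P.q n m)
    (simplexProj (P.fhat n m (enc.encode n (P.k n m) x))) (P.Z n m)

/-- The approximate distance `Ĉ_m` of the value at `x` to the part `m` of `Y`. -/
def Chat (P : ModelParams enc 𝒜 M) (L : ℕ) (m : Fin M) (x : X) : ℝ :=
  ∑ n ∈ Finset.range L, weightX D L n x *
    ∑ i, simplexProj (P.g n m (enc.encode n (P.k' n m) x)) i * |P.z n m i|

/-- The weight `[C^Y(x)]_m` in the approximate partition of `Y`. -/
def weightY (P : ModelParams enc 𝒜 M) (L : ℕ) (εA : ℝ) (m : Fin M) (x : X) : ℝ :=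
  open scoped Classical in
  (if P.Chat L m x ≤ εA / 4 then 1 else 0) /
    ∑ m' : Fin M, (if P.Chat L m' x ≤ εA / 4 then 1 else 0)

end ModelParams

/-- The lower bound
`1 - C₀ ∑ₘ (1-δ⋆)^(q m) f#μ(Yₘ) - C₁ L^(-r) - ∑_{n<L} C₂ μ(Xₙ) εs^(ρ n)` with `δ⋆ = S†(3 εs)`.
The tail term is absent when all parts are used, that is, when `L = N`. -/
def massBound (D : FeatureDecomposition X μ) {M : ℕ} (part : Fin M → Set Y) (S : ℝ → ℝ)
    (f : X → Y) (q : Fin M → ℝ) (C₀ C₁ C₂ : ℝ) (εs : ℝ) (L : ℕ) : ℝ :=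
  open scoped Classical in
  1 - C₀ * ∑ m, (1 - decInv S (3 * εs)) ^ q m * μ.real (f ⁻¹' part m)
    - (if (L : ℕ∞) < D.N then C₁ * (L : ℝ) ^ (-D.r) else 0)
    - ∑ n ∈ Finset.range L, C₂ * μ.real (D.part n) * εs ^ D.ρ n

/-- Positive constants in the bounds on the parameters; `n` is the index of the part of `X` and
`k` the encoding index. -/
structure RateConstants where
  Cd : ℕ → ℝ≥0
  CN : ℕ → ℝ≥0
  C₂ : ℕ → ℕ → ℝ≥0
  C₃ : ℕ → ℕ → ℝ≥0
  A : ℕ → ℕ → ℝ≥0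
  Cs : ℕ → ℕ → ℝ≥0
  Cd_pos : ∀ n, 0 < Cd n
  CN_pos : ∀ n, 0 < CN n
  C₂_pos : ∀ n k, 0 < C₂ n k
  C₃_pos : ∀ n k, 0 < C₃ n k
  A_pos : ∀ n k, 0 < A n k
  Cs_pos : ∀ n k, 0 < Cs n k

/-- The bounds on an encoding index `k`, a number of weights `N` and a complexity `c` over the part
`n` of `X`, for an encoding error `εd`, a scale `εN` and an approximation error `εc`; `p` is
the exponent of the mixing function. -/
structure ParamBounds (enc : BAPEncoding D) (ω : ℝ≥0 → ℝ≥0) (ωφ : ℕ → ℝ≥0 → ℝ≥0)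
    (𝓕 : UniversalApproximator) (B : RateConstants) (n k N c : ℕ) (εd εN εc : ℝ≥0)
    (p : ℕ) : Prop where
  k_le : k ≤ bapIndex (enc.T n) (D.feat n) (genInv (ωφ n) (genInv ω (εd / B.Cd n)))
  N_le : Real.log N ≤ B.CN n * Real.log (doublingConst (enc.T n k '' D.feat n)) *
    ⌈-Real.logb 2 (B.C₂ n k * genInv (fun t => ω (ωφ n t)) (B.C₃ n k * εN))⌉₊
  c_le : c ≤ 𝓕.rateInv (fun t => B.A n k / εc * ω (ωφ n t)) (enc.dim n k)
    (enc.encode n k '' D.core n) N (B.Cs n k * εc ^ p / NNReal.sqrt N)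

end Model

end

/-! On a good set the model collapses to a single point mass, so the theorem reduces to pointwise
estimates and a mass count. A good point lies in the support, is interior to one source part and
outside all others, and has its value in one of finitely many closed, pairwise separated regions `E
m` inside the target parts. There the source weights are the indicator of one part
(`weightX_eq_ite`) and a classifier makes the target weights an indicator too
(`exists_local_classifier`). Then `W1` is bounded by a distance in `Y`, and a barycenter map returns
the atom.

The local estimates rest on `exists_local_weights`. Put `Ω = ω ∘ ωφ n`, a continuous increasing
bijection of `[0,∞)`. Encode features by a finite-rank operator, take a maximal `s`-separated net in
the encoded set, and use normalized hat functions around the nodes as weights. Finite dimension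
bounds the number of hats active at a point, so the weights are Lipschitz at scale `s` independently
of the number of nodes; subadditivity turns this into a modulus proportional to `Ω / Ω s`. The
approximator reproduces the weights, and after projection onto the simplex only little mass sits on
nodes far from the argument. In `exists_local_map` the mixing inequality turns this concentration
into an error bound (`dist_eta_le`): near nodes have near values, far ones cost the diameter of the
values times the `p`-th root of their mass. Nodes are quantized inside the target part, where
`η`-convexity keeps the output. The classifier uses the same weights with two-valued labels on the
nodes.

For the mass, a uniform gap allows closures of the contracted parts at `δ⋆` as regions, with gap `S
δ⋆ = 3 εs`. Hausdorff separation alone gives no pointwise gap. But geometric stability as `δ → 1`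
makes the overlaps of target parts null for the law of `f`, so the points at distance at least `τ`
from all other parts exhaust the mass as `τ → 0`, and `σ` is adapted to `τ`
(`exists_separated_regions`). In the source, null overlaps and frontiers leave only the tail
(`exists_tail_bound`). The tail fixes `L`, and then `tendsto_massBound` provides `εs`. -/

noncomputable section

/-! ### Moduli of continuity -/

namespace IsHolderLikeModulus

variable {ω : ℝ≥0 → ℝ≥0}

theorem map_zero (h : IsHolderLikeModulus ω) : ω 0 = 0 := by
  obtain ⟨g, hg⟩ := h.scaling
  have h0 : g 0 = 0 := g.map_bot
  have := hg 0 0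
  simpa [h0] using this

/-- Scaling forces `ω` to be unbounded: `ω 1 ≤ g s * ω s⁻¹`, and `g s` can be made as small as
desired. The intermediate value theorem does the rest, so `genInv ω` is a genuine inverse. -/
theorem surjective (h : IsHolderLikeModulus ω) : Function.Surjective ω := by
  obtain ⟨g, hg⟩ := h.scaling
  have hpos : 0 < ω 1 := by
    have := h.strictMono (zero_lt_one (α := ℝ≥0))
    rwa [h.map_zero] at this
  have unbdd : ∀ y, ∃ x, y ≤ ω x := by
    intro y
    set a : ℝ≥0 := ω 1 / (y + 1) with ha
    have hapos : 0 < a := div_pos hpos (by positivity)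
    have hs : 0 < g.symm a := by
      have := g.symm.strictMono hapos
      rwa [show g.symm 0 = 0 from g.symm.map_bot] at this
    refine ⟨(g.symm a)⁻¹, ?_⟩
    have := hg (g.symm a) (g.symm a)⁻¹
    rw [mul_inv_cancel₀ hs.ne', g.apply_symm_apply, ha, div_mul_eq_mul_div,
      le_div_iff₀ (by positivity), mul_le_mul_iff_right₀ hpos] at this
    exact le_trans (by simp) this
  intro y
  obtain ⟨x, hx⟩ := unbdd y
  obtain ⟨z, -, hz⟩ := intermediate_value_Icc (zero_le (a := x)) h.continuous.continuousOn
    ⟨by rw [h.map_zero]; exact zero_le, hx⟩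
  exact ⟨z, hz⟩

theorem genInv_apply (h : IsHolderLikeModulus ω) (x : ℝ≥0) : genInv ω (ω x) = x := by
  have : {s | ω x ≤ ω s} = Ici x := by
    ext s
    exact h.strictMono.le_iff_le
  rw [genInv, this, csInf_Ici]

theorem apply_genInv (h : IsHolderLikeModulus ω) (t : ℝ≥0) : ω (genInv ω t) = t := by
  obtain ⟨x, rfl⟩ := h.surjective t
  rw [h.genInv_apply]

theorem comp {ω' : ℝ≥0 → ℝ≥0} (h : IsHolderLikeModulus ω) (h' : IsHolderLikeModulus ω') :
    IsHolderLikeModulus fun t => ω (ω' t) where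
  continuous := h.continuous.comp h'.continuous
  strictMono := h.strictMono.comp h'.strictMono
  subadditive s t := (h.strictMono.monotone (h'.subadditive s t)).trans (h.subadditive _ _)
  scaling := by
    obtain ⟨g, hg⟩ := h.scaling
    obtain ⟨g', hg'⟩ := h'.scaling
    exact ⟨g'.trans g, fun s t => (h.strictMono.monotone (hg' s t)).trans (hg _ _)⟩

/-- Collapses the nested inverses in the bound on the encoding index to the inverse of the composite
modulus. -/
theorem genInv_comp {ω' : ℝ≥0 → ℝ≥0} (h : IsHolderLikeModulus ω) (h' : IsHolderLikeModulus ω')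
    (t : ℝ≥0) : genInv ω' (genInv ω t) = genInv (fun t => ω (ω' t)) t := by
  apply (h.comp h').strictMono.injective
  refine Eq.trans ?_ ((h.comp h').apply_genInv t).symm
  simp only [h'.apply_genInv, h.apply_genInv]

theorem genInv_pos (h : IsHolderLikeModulus ω) {t : ℝ≥0} (ht : 0 < t) : 0 < genInv ω t := by
  rw [← h.strictMono.lt_iff_lt, h.map_zero, h.apply_genInv]
  exact ht

theorem map_nsmul_le (h : IsHolderLikeModulus ω) (n : ℕ) (t : ℝ≥0) : ω (n * t) ≤ n * ω t := by
  induction n with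
  | zero => simp [h.map_zero]
  | succ n ih =>
    push_cast
    rw [add_mul, add_mul, one_mul, one_mul]
    exact (h.subadditive _ _).trans (by gcongr)

theorem map_two_mul_le (h : IsHolderLikeModulus ω) (t : ℝ≥0) : ω (2 * t) ≤ 2 * ω t := by
  simpa using h.map_nsmul_le 2 t

/-- A modulus dominates a linear function truncated at scale `s`. -/
theorem min_div_mul_le (h : IsHolderLikeModulus ω) {s : ℝ≥0} (hs : 0 < s) (t : ℝ≥0) :
    min 1 (t / s) * ω s ≤ 2 * ω t := by
  rcases le_total s t with hst | hst
  · calc min 1 (t / s) * ω s ≤ 1 * ω t := by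
          gcongr
          · exact min_le_left _ _
          · exact h.strictMono.monotone hst
      _ ≤ 2 * ω t := by gcongr; norm_num
  · rcases eq_or_ne t 0 with rfl | ht
    · simp
    have ht' : 0 < t := pos_iff_ne_zero.2 ht
    -- `⌈s / t⌉₊` steps of length `t` reach `s`; rounding up costs at most a factor 2 because `s / t
    -- ≥ 1`.
    have hs' : ω s ≤ ⌈s / t⌉₊ * ω t := by
      refine le_trans (h.strictMono.monotone ?_) (h.map_nsmul_le _ _)
      rw [← div_le_iff₀ ht']
      exact Nat.le_ceil _
    have hc : (⌈s / t⌉₊ : ℝ≥0) ≤ 2 * (s / t) := by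
      have h1 : (1 : ℝ≥0) ≤ s / t := (one_le_div ht').2 hst
      calc (⌈s / t⌉₊ : ℝ≥0) ≤ s / t + 1 := (Nat.ceil_lt_add_one (by positivity)).le
        _ ≤ 2 * (s / t) := by rw [two_mul]; gcongr
    calc min 1 (t / s) * ω s ≤ (t / s) * (2 * (s / t) * ω t) := by
          gcongr
          · exact min_le_right _ _
          · exact hs'.trans (by gcongr)
      _ = 2 * ω t := by field_simp

end IsHolderLikeModulus

/-! ### Separated nets and doubling subsets of finite-dimensional spaces -/

/-- Existence of a maximal separated subset, given a uniform bound on the cardinalities. -/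
theorem exists_maximal_separated {Z : Type*} [PseudoMetricSpace Z] (A : Set Z) (r : ℝ)
    (b : ℕ) (hb : ∀ t : Finset Z, (t : Set Z) ⊆ A →
      (∀ x ∈ t, ∀ y ∈ t, x ≠ y → r ≤ dist x y) → t.card ≤ b) :
    ∃ t : Finset Z, (t : Set Z) ⊆ A ∧ (∀ x ∈ t, ∀ y ∈ t, x ≠ y → r ≤ dist x y) ∧
      (0 < r → ∀ x ∈ A, ∃ y ∈ t, dist x y < r) := by
  classical
  let P : ℕ → Prop := fun n => ∃ t : Finset Z, (t : Set Z) ⊆ A ∧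
      (∀ x ∈ t, ∀ y ∈ t, x ≠ y → r ≤ dist x y) ∧ t.card = n
  have h0 : P 0 := ⟨∅, by simp, by simp, rfl⟩
  -- A separated set of greatest cardinality: an uncovered point could be inserted into it.
  obtain ⟨t, htA, hts, htc⟩ : P (Nat.findGreatest P b) := Nat.findGreatest_spec (Nat.zero_le b) h0
  refine ⟨t, htA, hts, fun hr x hx => ?_⟩
  by_contra! hcon
  have hxt : x ∉ t := fun hxt => by
    have := hcon x hxt
    rw [dist_self] at this
    linarith
  have hins : P (t.card + 1) := by
    refine ⟨insert x t, ?_, ?_, Finset.card_insert_of_notMem hxt⟩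
    · rw [Finset.coe_insert]
      exact insert_subset hx htA
    · intro y hy z hz hyz
      rcases Finset.mem_insert.1 hy with hy | hy <;> rcases Finset.mem_insert.1 hz with hz | hz
      · exact absurd (hy.trans hz.symm) hyz
      · rw [hy]; exact hcon z hz
      · rw [hz, dist_comm]; exact hcon y hy
      · exact hts y hy z hz hyz
  have hle : t.card + 1 ≤ b := by
    obtain ⟨t', h1, h2, h3⟩ := hins
    rw [← h3]
    exact hb t' h1 h2
  have := Nat.le_findGreatest hle hins
  omega

/-- Translating by `v` and scaling by `1 / r` gives a 1-separated subset of the ball of radius 2,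
whose size a volume comparison bounds by `5 ^ dim`. -/
theorem card_le_of_separated_of_dist_le {E : Type*} [NormedAddCommGroup E] [NormedSpace ℝ E]
    [FiniteDimensional ℝ E] (v : E) {r : ℝ} (hr : 0 < r) (t : Finset E)
    (ht : ∀ x ∈ t, dist x v ≤ 2 * r) (hs : ∀ x ∈ t, ∀ y ∈ t, x ≠ y → r ≤ dist x y) :
    t.card ≤ 5 ^ Module.finrank ℝ E := by
  classical
  have hinj : Function.Injective fun x : E => r⁻¹ • (x - v) := by
    intro x y hxy
    have := smul_right_injective E (inv_ne_zero hr.ne') hxy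
    exact sub_left_injective this
  rw [← Finset.card_image_of_injective t hinj]
  apply Besicovitch.card_le_of_separated
  · intro c hc
    obtain ⟨x, hx, rfl⟩ := Finset.mem_image.1 hc
    rw [norm_smul, norm_inv, Real.norm_of_nonneg hr.le, ← dist_eq_norm, inv_mul_le_iff₀ hr]
    linarith [ht x hx]
  · intro c hc d hd hcd
    obtain ⟨x, hx, rfl⟩ := Finset.mem_image.1 hc
    obtain ⟨y, hy, rfl⟩ := Finset.mem_image.1 hd
    have hxy : x ≠ y := fun h => hcd (by rw [h])
    rw [← smul_sub, sub_sub_sub_cancel_right, norm_smul, norm_inv, Real.norm_of_nonneg hr.le,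
      ← dist_eq_norm, le_inv_mul_iff₀ hr]
    linarith [hs x hx y hy hxy]

/-- Subsets of finite-dimensional subspaces are doubling. -/
theorem isDoubling_of_subset_submodule {F : Type*} [NormedAddCommGroup F] [NormedSpace ℝ F]
    (V : Submodule ℝ F) [FiniteDimensional ℝ V] (A : Set F) (hA : A ⊆ V) : IsDoubling A := by
  classical
  refine ⟨5 ^ Module.finrank ℝ V, fun x hx r hr => ?_⟩
  have hcard : ∀ t : Finset V,
      (t : Set V) ⊆ (fun v : V => (v : F)) ⁻¹' (Metric.ball x (2 * r) ∩ A) →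
      (∀ y ∈ t, ∀ z ∈ t, y ≠ z → r ≤ dist y z) → t.card ≤ 5 ^ Module.finrank ℝ V :=
    fun t ht hs =>
      card_le_of_separated_of_dist_le ⟨x, hA hx⟩ hr t (fun y hy => (ht hy).1.le) hs
  -- The net is taken in `V`, where the packing bound holds, and among points of `A`, where the
  -- centres have to lie.
  obtain ⟨t, ht, hsep, hcov⟩ := exists_maximal_separated
    ((fun v : V => (v : F)) ⁻¹' (Metric.ball x (2 * r) ∩ A)) r
    (5 ^ Module.finrank ℝ V) hcard
  refine ⟨t.image (fun v : V => (v : F)), ?_, ?_, ?_⟩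
  · intro y hy
    obtain ⟨z, hz, rfl⟩ := Finset.mem_image.1 (Finset.mem_coe.1 hy)
    exact (ht hz).2
  · exact Finset.card_image_le.trans (hcard t ht hsep)
  · intro y hy
    obtain ⟨z, hz, hyz⟩ := hcov hr ⟨y, hA hy.2⟩ hy
    exact mem_iUnion₂.2 ⟨z, Finset.mem_image_of_mem _ hz, hyz⟩

theorem IsDoubling.doublingConst_spec {Z : Type*} [PseudoMetricSpace Z] {A : Set Z}
    (h : IsDoubling A) : IsDoublingWith A (doublingConst A) := Nat.sInf_mem h

/-- Iterated covering: a ball is covered by `C ^ j` balls of `2 ^ j` times smaller radius. -/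
theorem IsDoublingWith.exists_cover {Z : Type*} [PseudoMetricSpace Z] {A : Set Z} {C : ℕ}
    (h : IsDoublingWith A C) {x : Z} (hx : x ∈ A) {R : ℝ} (hR : 0 < R)
    (hA : A ⊆ Metric.ball x R) (j : ℕ) :
    ∃ t : Finset Z, (t : Set Z) ⊆ A ∧ t.card ≤ C ^ j ∧
      A ⊆ ⋃ y ∈ t, Metric.ball y (R / 2 ^ j) := by
  classical
  induction j with
  | zero => exact ⟨{x}, by simpa using hx, by simp, by simpa using hA⟩
  | succ j ih =>
    obtain ⟨t, htA, htc, hcov⟩ := ih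
    have hr : 0 < R / 2 ^ (j + 1) := by positivity
    have hr2 : 2 * (R / 2 ^ (j + 1)) = R / 2 ^ j := by field_simp; ring
    choose! u huA huc hu using fun y (hy : y ∈ t) => h y (htA hy) _ hr
    refine ⟨t.biUnion u, ?_, ?_, ?_⟩
    · intro y hy
      obtain ⟨z, hz, hyz⟩ := Finset.mem_biUnion.1 (Finset.mem_coe.1 hy)
      exact huA z hz hyz
    · calc (t.biUnion u).card ≤ t.card * C := Finset.card_biUnion_le_card_mul _ _ _ huc
        _ ≤ C ^ j * C := Nat.mul_le_mul_right _ htc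
        _ = C ^ (j + 1) := (pow_succ _ _).symm
    · intro y hy
      obtain ⟨z, hz, hyz⟩ := mem_iUnion₂.1 (hcov hy)
      obtain ⟨v, hv, hyv⟩ := mem_iUnion₂.1 (hu z hz ⟨by rwa [hr2], hy⟩)
      exact mem_iUnion₂.2 ⟨v, Finset.mem_biUnion.2 ⟨z, hz, hv⟩, hyv⟩

/-- Separated subsets of a bounded doubling set. -/
theorem IsDoublingWith.card_le {Z : Type*} [PseudoMetricSpace Z] {A : Set Z} {C : ℕ}
    (h : IsDoublingWith A C) {x : Z} (hx : x ∈ A) {R : ℝ} (hR : 0 < R)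
    (hA : A ⊆ Metric.ball x R) {j : ℕ} {s : ℝ} (hj : 2 * R ≤ 2 ^ j * s) (t : Finset Z)
    (htA : (t : Set Z) ⊆ A) (ht : ∀ x ∈ t, ∀ y ∈ t, x ≠ y → s ≤ dist x y) :
    t.card ≤ C ^ j := by
  -- Two points of one ball of radius `R / 2 ^ j` are less than `s` apart, so each ball holds at
  -- most one point of `t`.
  obtain ⟨u, -, huc, hcov⟩ := h.exists_cover hx hR hA j
  refine le_trans ?_ huc
  have : ∀ y ∈ t, ∃ z ∈ u, dist y z < R / 2 ^ j := fun y hy => by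
    obtain ⟨z, hz, hyz⟩ := mem_iUnion₂.1 (hcov (htA hy))
    exact ⟨z, hz, hyz⟩
  choose! g hgu hg using this
  refine Finset.card_le_card_of_injOn g hgu fun y hy z hz hyz => ?_
  by_contra hne
  have h1 := ht y hy z hz hne
  have h2 := hg y hy
  have h3 := hg z hz
  rw [← hyz] at h3
  have h4 := dist_triangle_right y z (g y)
  have h5 : s < R / 2 ^ j + R / 2 ^ j := by linarith
  rw [← two_mul, ← mul_div_assoc, lt_div_iff₀ (by positivity)] at h5
  linarith

/-! ### Projection onto the simplex -/

theorem simplexProj_spec {N : ℕ} (hN : 1 ≤ N) (v : Euc N) :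
    simplexProj v ∈ stdSimplex ℝ (Fin N) ∧
      ∀ w' ∈ stdSimplex ℝ (Fin N),
        dist v (WithLp.toLp 2 (simplexProj v)) ≤ dist v (WithLp.toLp 2 w') := by
  have : NeZero N := ⟨by omega⟩
  have hne : (stdSimplex ℝ (Fin N)).Nonempty := ⟨_, single_mem_stdSimplex ℝ (0 : Fin N)⟩
  have hcont : Continuous fun w : Fin N → ℝ => dist v (WithLp.toLp 2 w) :=
    continuous_const.dist (PiLp.continuous_toLp 2 _)
  obtain ⟨w, hw, hmin⟩ := (isCompact_stdSimplex ℝ (Fin N)).exists_isMinOn hne hcont.continuousOn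
  exact Classical.epsilon_spec (p := fun w : Fin N → ℝ => w ∈ stdSimplex ℝ (Fin N) ∧
    ∀ w' ∈ stdSimplex ℝ (Fin N), dist v (WithLp.toLp 2 w) ≤ dist v (WithLp.toLp 2 w'))
    ⟨w, hw, fun w' hw' => hmin hw'⟩

theorem sum_abs_le_sqrt_mul_norm {N : ℕ} (v : Euc N) :
    ∑ i, |v i| ≤ √N * ‖v‖ := by
  rw [EuclideanSpace.norm_eq, ← Real.sqrt_mul (Nat.cast_nonneg _)]
  apply Real.le_sqrt_of_sq_le
  simpa using sq_sum_le_card_mul_sum_sq (s := Finset.univ) (f := fun i => |v i|)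

theorem norm_le_sum_abs {N : ℕ} (v : Euc N) : ‖v‖ ≤ ∑ i, |v i| := by
  rw [EuclideanSpace.norm_eq]
  apply Real.sqrt_le_iff.2 ⟨Finset.sum_nonneg fun i _ => abs_nonneg _, ?_⟩
  simpa using Finset.sum_sq_le_sq_sum_of_nonneg (s := Finset.univ) (f := fun i => |v i|)
    (fun i _ => abs_nonneg _)

/-- The total variation error caused by projecting a perturbation of a point of the simplex. -/
theorem sum_abs_simplexProj_sub_le {N : ℕ} (hN : 1 ≤ N) (v w : Euc N)
    (hw : w.ofLp ∈ stdSimplex ℝ (Fin N)) :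
    ∑ i, |simplexProj v i - w i| ≤ √N * (2 * ‖w - v‖) := by
  -- `w` competes in the minimization, so the projection is no farther from `v` than `w` is. This
  -- gives the factor 2.
  have h := (simplexProj_spec hN v).2 _ hw
  refine (sum_abs_le_sqrt_mul_norm (WithLp.toLp 2 (simplexProj v) - w)).trans ?_
  gcongr
  rw [← dist_eq_norm]
  have h1 := dist_triangle_left (WithLp.toLp 2 (simplexProj v)) w v
  rw [WithLp.toLp_ofLp] at h
  rw [← dist_eq_norm, dist_comm w v]
  linarith

/-- The mass which the projection of a perturbation puts on the zero set of a point of the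
simplex. -/
theorem sum_simplexProj_filter_le {N : ℕ} (hN : 1 ≤ N) (v w : Euc N)
    (hw : w.ofLp ∈ stdSimplex ℝ (Fin N)) {a e : ℝ} (hb : ‖w - v‖ ≤ a * e / √N) :
    ∑ i ∈ Finset.univ.filter (fun i => w i = 0), simplexProj v i ≤ 2 * a * e := by
  have hsq : 0 < √(N : ℝ) := Real.sqrt_pos.2 (by exact_mod_cast hN)
  calc ∑ i ∈ Finset.univ.filter (fun i => w i = 0), simplexProj v i
      = ∑ i ∈ Finset.univ.filter (fun i => w i = 0), (simplexProj v i - w i) := by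
        refine Finset.sum_congr rfl fun i hi => ?_
        rw [(Finset.mem_filter.1 hi).2, sub_zero]
    _ ≤ ∑ i ∈ Finset.univ.filter (fun i => w i = 0), |simplexProj v i - w i| :=
        Finset.sum_le_sum fun i _ => le_abs_self _
    _ ≤ ∑ i, |simplexProj v i - w i| :=
        Finset.sum_le_sum_of_subset_of_nonneg (Finset.subset_univ _) fun i _ _ => abs_nonneg _
    _ ≤ √N * (2 * ‖w - v‖) := sum_abs_simplexProj_sub_le hN v w hw
    _ ≤ √N * (2 * (a * e / √N)) := by gcongr
    _ = 2 * a * e := by field_simp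

/-! ### Weighted means -/

/-- Minkowski's inequality in weighted `ℓᵖ` for `d ≤ e + b · 1_s`: the constant has norm `e` and the
indicator part has norm `b` times the `p`-th root of the mass of `s`. The weights enter as factors
`w i ^ (1 / p)`. -/
theorem weighted_mean_le {N : ℕ} {w : Fin N → ℝ} (hw : w ∈ stdSimplex ℝ (Fin N)) {p : ℕ}
    (hp : 1 ≤ p) {d : Fin N → ℝ} (hd : ∀ i, 0 ≤ d i) (s : Finset (Fin N)) {e b κ : ℝ} (he : 0 ≤ e)
    (hb : 0 ≤ b) (hnear : ∀ i ∉ s, d i ≤ e) (hfar : ∀ i ∈ s, d i ≤ e + b)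
    (hκ : ∑ i ∈ s, w i ≤ κ) :
    (∑ i, d i ^ p * w i) ^ (1 / (p : ℝ)) ≤ e + b * κ ^ (1 / (p : ℝ)) := by
  classical
  have hp0 : (p : ℝ) ≠ 0 := by positivity
  have hpow : ∀ x y : ℝ, 0 ≤ x → 0 ≤ y → (x * y ^ (1 / (p : ℝ))) ^ (p : ℝ) = x ^ p * y := by
    intro x y hx hy
    rw [Real.mul_rpow hx (by positivity), ← Real.rpow_mul hy, one_div_mul_cancel hp0,
      Real.rpow_one, Real.rpow_natCast]
  have hroot : ∀ x y : ℝ, 0 ≤ x → 0 ≤ y →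
      (x ^ p * y) ^ (1 / (p : ℝ)) = x * y ^ (1 / (p : ℝ)) := by
    intro x y hx hy
    rw [Real.mul_rpow (by positivity) hy, ← Real.rpow_natCast, ← Real.rpow_mul hx,
      mul_one_div_cancel hp0, Real.rpow_one]
  have hκ0 : 0 ≤ ∑ i ∈ s, w i := Finset.sum_nonneg fun i _ => hw.1 i
  let g : Fin N → ℝ := fun i => if i ∈ s then b else 0
  have hg : ∀ i, 0 ≤ g i := fun i => by dsimp only [g]; split_ifs <;> simp [hb]
  have hdg : ∀ i, d i ≤ e + g i := fun i => by
    dsimp only [g]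
    split_ifs with h
    · exact hfar i h
    · simpa using hnear i h
  have h1 : ∑ i, d i ^ p * w i ≤
      ∑ i, (e * w i ^ (1 / (p : ℝ)) + g i * w i ^ (1 / (p : ℝ))) ^ (p : ℝ) := by
    refine Finset.sum_le_sum fun i _ => ?_
    rw [← add_mul, hpow _ _ (add_nonneg he (hg i)) (hw.1 i)]
    have := hw.1 i
    have := hd i
    gcongr
    exact hdg i
  refine (Real.rpow_le_rpow (Finset.sum_nonneg fun i _ =>
    mul_nonneg (pow_nonneg (hd i) _) (hw.1 i)) h1 (by positivity)).trans ?_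
  refine (Real.Lp_add_le_of_nonneg Finset.univ (by exact_mod_cast hp)
    (fun i _ => mul_nonneg he (Real.rpow_nonneg (hw.1 i) _))
    (fun i _ => mul_nonneg (hg i) (Real.rpow_nonneg (hw.1 i) _))).trans ?_
  have h2 : ∑ i, (e * w i ^ (1 / (p : ℝ))) ^ (p : ℝ) = e ^ p * 1 := by
    have : ∑ i, e ^ p * w i = e ^ p * 1 := by rw [← Finset.mul_sum, hw.2]
    rw [← this]
    exact Finset.sum_congr rfl fun i _ => hpow _ _ he (hw.1 i)
  have h3 : ∑ i, (g i * w i ^ (1 / (p : ℝ))) ^ (p : ℝ) = b ^ p * ∑ i ∈ s, w i := by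
    have h4 : ∀ i, (g i * w i ^ (1 / (p : ℝ))) ^ (p : ℝ) = if i ∈ s then b ^ p * w i else 0 := by
      intro i
      rw [hpow _ _ (hg i) (hw.1 i)]
      dsimp only [g]
      split_ifs
      · rfl
      · rw [zero_pow (by omega), zero_mul]
    rw [Finset.sum_congr rfl fun i _ => h4 i, ← Finset.sum_filter, Finset.mul_sum]
    simp
  rw [h2, h3, hroot _ _ he zero_le_one, hroot _ _ hb hκ0, Real.one_rpow, mul_one]
  gcongr

/-! ### Partitions of unity subordinate to separated nets -/

section NetWeights

variable {E : Type*} [NormedAddCommGroup E]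

/-- The hat function of width `2 s` around `p`. -/
def hatBump (s : ℝ) (p v : E) : ℝ := max 0 (1 - dist v p / (2 * s))

/-- The sum of the hat functions around the points `p i`, cut off from below. -/
def hatTotal {N : ℕ} (s : ℝ) (p : Fin N → E) (v : E) : ℝ := max (1 / 2) (∑ i, hatBump s (p i) v)

/-- Weights subordinate to the `2 s`-balls around the points `p i`. They sum to `1` on the
`s`-neighbourhood of the points. -/
def netWeights {N : ℕ} (s : ℝ) (p : Fin N → E) (v : E) : Euc N :=
  WithLp.toLp 2 fun i => hatBump s (p i) v / hatTotal s p v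

theorem hatBump_nonneg (s : ℝ) (p v : E) : 0 ≤ hatBump s p v := le_max_left _ _

theorem hatBump_eq_zero {s : ℝ} (hs : 0 < s) {p v : E} (h : 2 * s ≤ dist v p) :
    hatBump s p v = 0 := by
  apply max_eq_left
  rw [sub_nonpos, one_le_div (by positivity)]
  exact h

theorem abs_hatBump_sub_le {s : ℝ} (hs : 0 < s) (p v v' : E) :
    |hatBump s p v - hatBump s p v'| ≤ dist v v' / (2 * s) := by
  refine (abs_max_sub_max_le_max _ _ _ _).trans ?_
  rw [sub_zero, abs_zero, max_eq_right (abs_nonneg _), sub_sub_sub_cancel_left, ← sub_div, abs_div,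
    abs_of_pos (show 0 < 2 * s by positivity)]
  gcongr
  rw [dist_comm v v']
  exact abs_dist_sub_le _ _ _

theorem hatTotal_pos {N : ℕ} (s : ℝ) (p : Fin N → E) (v : E) : 0 < hatTotal s p v :=
  lt_of_lt_of_le (by norm_num) (le_max_left _ _)

theorem netWeights_apply {N : ℕ} (s : ℝ) (p : Fin N → E) (v : E) (i : Fin N) :
    netWeights s p v i = hatBump s (p i) v / hatTotal s p v := rfl

theorem netWeights_nonneg {N : ℕ} (s : ℝ) (p : Fin N → E) (v : E) (i : Fin N) :
    0 ≤ netWeights s p v i := div_nonneg (hatBump_nonneg _ _ _) (hatTotal_pos _ _ _).le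

theorem sum_netWeights_le_one {N : ℕ} (s : ℝ) (p : Fin N → E) (v : E) :
    ∑ i, netWeights s p v i ≤ 1 := by
  simp only [netWeights_apply]
  rw [← Finset.sum_div, div_le_one (hatTotal_pos _ _ _)]
  exact le_max_right _ _

theorem netWeights_eq_zero {N : ℕ} {s : ℝ} (hs : 0 < s) (p : Fin N → E) (v : E) {i : Fin N}
    (h : 2 * s ≤ dist v (p i)) : netWeights s p v i = 0 := by
  rw [netWeights_apply, hatBump_eq_zero hs h, zero_div]

/-- Within distance `s` of a node the hat of width `2 s` is at least `1 / 2`, so the cut-off in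
`hatTotal` is inactive and the normalization is exact. -/
theorem netWeights_mem_stdSimplex {N : ℕ} {s : ℝ} (hs : 0 < s) (p : Fin N → E) {v : E}
    (h : ∃ i, dist v (p i) < s) : (netWeights s p v).ofLp ∈ stdSimplex ℝ (Fin N) := by
  refine ⟨netWeights_nonneg s p v, ?_⟩
  obtain ⟨i, hi⟩ := h
  have h1 : (1 / 2 : ℝ) ≤ hatBump s (p i) v := by
    refine le_trans ?_ (le_max_right _ _)
    have : dist v (p i) / (2 * s) ≤ 1 / 2 := by
      rw [div_le_div_iff₀ (by positivity) (by norm_num)]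
      linarith
    linarith
  have h2 : (1 / 2 : ℝ) ≤ ∑ i, hatBump s (p i) v :=
    h1.trans (Finset.single_le_sum (fun j _ => hatBump_nonneg s (p j) v) (Finset.mem_univ i))
  have h3 : hatTotal s p v = ∑ i, hatBump s (p i) v := max_eq_right h2
  change ∑ i, hatBump s (p i) v / hatTotal s p v = 1
  rw [← Finset.sum_div, h3, div_self]
  linarith

theorem norm_netWeights_sub_le_two {N : ℕ} (s : ℝ) (p : Fin N → E) (v v' : E) :
    ‖netWeights s p v - netWeights s p v'‖ ≤ 2 := by
  refine (norm_le_sum_abs _).trans ?_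
  calc ∑ i, |(netWeights s p v - netWeights s p v') i|
      ≤ ∑ i, (netWeights s p v i + netWeights s p v' i) := by
        refine Finset.sum_le_sum fun i _ => ?_
        change |netWeights s p v i - netWeights s p v' i| ≤ _
        have h1 := netWeights_nonneg s p v i
        have h2 := netWeights_nonneg s p v' i
        exact abs_le.2 ⟨by linarith, by linarith⟩
    _ ≤ 2 := by
        rw [Finset.sum_add_distrib]
        linarith [sum_netWeights_le_one s p v, sum_netWeights_le_one s p v']

variable [NormedSpace ℝ E] [FiniteDimensional ℝ E]

/-- Bounds the number of hats active at a point by the dimension alone, which keeps the Lipschitz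
constant of the weights free of the number of nodes. -/
theorem card_filter_dist_lt_le {N : ℕ} {s : ℝ} (hs : 0 < s) (p : Fin N → E)
    (hp : ∀ i j, i ≠ j → s ≤ dist (p i) (p j)) (v : E) :
    (Finset.univ.filter fun i => dist v (p i) < 2 * s).card ≤ 5 ^ Module.finrank ℝ E := by
  classical
  have hinj : Function.Injective p := fun i j hij => by
    by_contra hne
    have := hp i j hne
    rw [hij, dist_self] at this
    linarith
  rw [← Finset.card_image_of_injective _ hinj]
  apply card_le_of_separated_of_dist_le v hs
  · intro x hx
    obtain ⟨i, hi, rfl⟩ := Finset.mem_image.1 hx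
    rw [dist_comm]
    exact (Finset.mem_filter.1 hi).2.le
  · intro x hx y hy hxy
    obtain ⟨i, hi, rfl⟩ := Finset.mem_image.1 hx
    obtain ⟨j, hj, rfl⟩ := Finset.mem_image.1 hy
    exact hp i j fun h => hxy (by rw [h])

/-- Only hats active at `v` or at `v'` contribute, at most `2 * 5 ^ dim` of them, and each is `1 /
(2 s)`-Lipschitz. -/
theorem sum_abs_hatBump_sub_le {N : ℕ} {s : ℝ} (hs : 0 < s) (p : Fin N → E)
    (hp : ∀ i j, i ≠ j → s ≤ dist (p i) (p j)) (v v' : E) :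
    ∑ i, |hatBump s (p i) v - hatBump s (p i) v'| ≤
      5 ^ Module.finrank ℝ E * (dist v v' / s) := by
  classical
  set I := (Finset.univ.filter fun i => dist v (p i) < 2 * s) ∪
    Finset.univ.filter fun i => dist v' (p i) < 2 * s with hI
  have hcard : (I.card : ℝ) ≤ 2 * 5 ^ Module.finrank ℝ E := by
    have := (Finset.card_union_le _ _).trans
      (add_le_add (card_filter_dist_lt_le hs p hp v) (card_filter_dist_lt_le hs p hp v'))
    rw [← two_mul] at this
    exact_mod_cast this
  have hsum : ∑ i, |hatBump s (p i) v - hatBump s (p i) v'| =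
      ∑ i ∈ I, |hatBump s (p i) v - hatBump s (p i) v'| := by
    refine (Finset.sum_subset (Finset.subset_univ _) fun i _ hi => ?_).symm
    simp only [hI, Finset.mem_union, Finset.mem_filter, Finset.mem_univ, true_and, not_or,
      not_lt] at hi
    rw [hatBump_eq_zero hs hi.1, hatBump_eq_zero hs hi.2, sub_zero, abs_zero]
  rw [hsum]
  calc ∑ i ∈ I, |hatBump s (p i) v - hatBump s (p i) v'|
      ≤ ∑ _i ∈ I, dist v v' / (2 * s) :=
        Finset.sum_le_sum fun i _ => abs_hatBump_sub_le hs _ _ _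
    _ = I.card * (dist v v' / (2 * s)) := by rw [Finset.sum_const, nsmul_eq_mul]
    _ ≤ 2 * 5 ^ Module.finrank ℝ E * (dist v v' / (2 * s)) := by gcongr
    _ = 5 ^ Module.finrank ℝ E * (dist v v' / s) := by field_simp

/-- A quotient rule: since the denominator is at least `1 / 2`, the change of the numerators and the
change of the denominator each cost at most `2 Δ`. -/
theorem norm_netWeights_sub_le {N : ℕ} {s : ℝ} (hs : 0 < s) (p : Fin N → E)
    (hp : ∀ i j, i ≠ j → s ≤ dist (p i) (p j)) (v v' : E) :
    ‖netWeights s p v - netWeights s p v'‖ ≤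
      4 * 5 ^ Module.finrank ℝ E * (dist v v' / s) := by
  set Δ := ∑ i, |hatBump s (p i) v - hatBump s (p i) v'| with hΔ
  have hΔ0 : 0 ≤ Δ := Finset.sum_nonneg fun i _ => abs_nonneg _
  have hm := hatTotal_pos s p v
  have hm' := hatTotal_pos s p v'
  have hm2 : (hatTotal s p v)⁻¹ ≤ 2 := by
    rw [inv_le_comm₀ hm two_pos]
    exact le_trans (by norm_num) (le_max_left _ _)
  have htot : |hatTotal s p v' - hatTotal s p v| ≤ Δ := by
    refine (abs_max_sub_max_le_max _ _ _ _).trans ?_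
    rw [sub_self, abs_zero, max_eq_right (abs_nonneg _), ← Finset.sum_sub_distrib]
    exact (Finset.abs_sum_le_sum_abs _ _).trans
      (le_of_eq (Finset.sum_congr rfl fun i _ => abs_sub_comm _ _))
  have hterm : ∀ i, |(netWeights s p v - netWeights s p v') i| ≤
      2 * |hatBump s (p i) v - hatBump s (p i) v'| + 2 * Δ * netWeights s p v' i := by
    intro i
    have heq : (netWeights s p v - netWeights s p v') i =
        (hatBump s (p i) v - hatBump s (p i) v') * (hatTotal s p v)⁻¹ +
        netWeights s p v' i * ((hatTotal s p v' - hatTotal s p v) * (hatTotal s p v)⁻¹) := by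
      change hatBump s (p i) v / hatTotal s p v - hatBump s (p i) v' / hatTotal s p v' = _
      rw [netWeights_apply]
      field_simp
      ring
    rw [heq]
    refine (abs_add_le _ _).trans (add_le_add ?_ ?_)
    · rw [abs_mul, abs_of_pos (inv_pos.2 hm), mul_comm]
      gcongr
    · rw [abs_mul, abs_mul, abs_of_pos (inv_pos.2 hm), abs_of_nonneg (netWeights_nonneg s p v' i),
        mul_comm]
      have h1 := netWeights_nonneg s p v' i
      have h2 : |hatTotal s p v' - hatTotal s p v| * (hatTotal s p v)⁻¹ ≤ Δ * 2 := by gcongr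
      calc |hatTotal s p v' - hatTotal s p v| * (hatTotal s p v)⁻¹ * netWeights s p v' i
          ≤ Δ * 2 * netWeights s p v' i := by gcongr
        _ = 2 * Δ * netWeights s p v' i := by ring
  refine (norm_le_sum_abs _).trans ((Finset.sum_le_sum fun i _ => hterm i).trans ?_)
  rw [Finset.sum_add_distrib, ← Finset.mul_sum, ← Finset.mul_sum, ← hΔ]
  have h1 : 2 * Δ * ∑ i, netWeights s p v' i ≤ 2 * Δ * 1 := by
    gcongr
    exact sum_netWeights_le_one s p v'
  have h2 := sum_abs_hatBump_sub_le hs p hp v v'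
  linarith

/-- The weights have modulus of continuity proportional to `Ω / Ω(s)` for every modulus `Ω`. -/
theorem norm_netWeights_sub_le_modulus {N : ℕ} {s : ℝ≥0} (hs : 0 < s) (p : Fin N → E)
    (hp : ∀ i j, i ≠ j → (s : ℝ) ≤ dist (p i) (p j)) {Ω : ℝ≥0 → ℝ≥0}
    (hΩ : IsHolderLikeModulus Ω) {v v' : E} {a t : ℝ≥0} (hvv : dist v v' ≤ a * t) :
    ‖netWeights s p v - netWeights s p v'‖ * Ω s ≤
      2 * (2 + 4 * 5 ^ Module.finrank ℝ E * a) * Ω t := by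
  have h1 := norm_netWeights_sub_le_two (s : ℝ) p v v'
  have h2 := norm_netWeights_sub_le (NNReal.coe_pos.2 hs) p hp v v'
  -- The trivial bound 2 serves for `t ≥ s`, the Lipschitz bound for `t ≤ s`; the sum of both
  -- constants covers both cases.
  have h3 : ‖netWeights s p v - netWeights s p v'‖ ≤
      (2 + 4 * 5 ^ Module.finrank ℝ E * a) * min 1 ((t : ℝ) / s) := by
    have ha : 0 ≤ 4 * 5 ^ Module.finrank ℝ E * (a : ℝ) := by positivity
    have hts : 0 ≤ (t : ℝ) / s := by positivity
    rcases le_total 1 ((t : ℝ) / s) with h | h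
    · rw [min_eq_left h]; linarith
    · rw [min_eq_right h]
      have h4 : 4 * 5 ^ Module.finrank ℝ E * (dist v v' / s) ≤
          4 * 5 ^ Module.finrank ℝ E * (a * t / s) := by gcongr
      have h5 : 4 * 5 ^ Module.finrank ℝ E * ((a : ℝ) * t / s) =
          4 * 5 ^ Module.finrank ℝ E * a * (t / s) := by ring
      rw [add_mul]
      linarith
  have h4 : min 1 ((t : ℝ) / s) * Ω s ≤ 2 * Ω t := by
    exact_mod_cast hΩ.min_div_mul_le hs t
  calc ‖netWeights s p v - netWeights s p v'‖ * Ω s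
      ≤ (2 + 4 * 5 ^ Module.finrank ℝ E * a) * min 1 ((t : ℝ) / s) * Ω s := by gcongr
    _ = (2 + 4 * 5 ^ Module.finrank ℝ E * a) * (min 1 ((t : ℝ) / s) * Ω s) := by ring
    _ ≤ (2 + 4 * 5 ^ Module.finrank ℝ E * a) * (2 * Ω t) := by gcongr
    _ = _ := by ring

end NetWeights

/-! ### The constants in the parameter bounds -/

section Encoding

variable {X : Type*} [MetricSpace X] [MeasurableSpace X] {μ : Measure X}
  {D : FeatureDecomposition X μ}

theorem BAPEncoding.finiteDimensional_range (enc : BAPEncoding D) (n k : ℕ) :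
    FiniteDimensional ℝ (LinearMap.range (enc.T n k : D.F n →ₗ[ℝ] D.F n)) :=
  (enc.ι n k).finiteDimensional

theorem BAPEncoding.finrank_range (enc : BAPEncoding D) (n k : ℕ) :
    Module.finrank ℝ (LinearMap.range (enc.T n k : D.F n →ₗ[ℝ] D.F n)) = enc.dim n k := by
  rw [← (enc.ι n k).finrank_eq, finrank_euclideanSpace_fin]

/-- The norm of a linear map on a Euclidean space. -/
def linNorm {d : ℕ} {V : Type*} [NormedAddCommGroup V] [NormedSpace ℝ V] (L : Euc d →ₗ[ℝ] V) :
    ℝ≥0 := ‖LinearMap.toContinuousLinearMap L‖₊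

theorem dist_le_linNorm_mul {d : ℕ} {V : Type*} [NormedAddCommGroup V] [NormedSpace ℝ V]
    (L : Euc d →ₗ[ℝ] V) (u u' : Euc d) : dist (L u) (L u') ≤ linNorm L * nndist u u' := by
  rw [coe_nndist, dist_eq_norm, dist_eq_norm, ← map_sub]
  exact (LinearMap.toContinuousLinearMap L).le_opNorm (u - u')

/-- The norm of the coordinate map of the range of `T n k`. -/
def BAPEncoding.coordNorm (enc : BAPEncoding D) (n k : ℕ) : ℝ≥0 := linNorm (enc.ι n k).toLinearMap

theorem BAPEncoding.dist_coord_le (enc : BAPEncoding D) (n k : ℕ) (u u' : Euc (enc.dim n k)) :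
    dist (enc.ι n k u) (enc.ι n k u') ≤ enc.coordNorm n k * nndist u u' :=
  dist_le_linNorm_mul (enc.ι n k).toLinearMap u u'

/-- A bound for the radius of the image of the support under `T n k ∘ φ n`. -/
def BAPEncoding.radius (enc : BAPEncoding D) (n k : ℕ) : ℝ≥0 :=
  (Metric.diam (enc.T n k '' D.feat n)).toNNReal + 1

theorem BAPEncoding.radius_pos (enc : BAPEncoding D) (n k : ℕ) : 0 < enc.radius n k := by
  unfold BAPEncoding.radius
  positivity

/-- Constants admissible in the parameter bounds, for a mixing function with constant `C` and
exponent `p`. -/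
def rateConstants (enc : BAPEncoding D) (ω : ℝ≥0 → ℝ≥0) (ωφ : ℕ → ℝ≥0 → ℝ≥0) (C : ℝ≥0)
    (hC : 0 < C) (p : ℕ) : RateConstants where
  Cd _ := 48 * C
  CN _ := 1
  C₂ n k := 1 / (2 * enc.radius n k)
  C₃ _ _ := 1 / (48 * C)
  A n k := 96 * C * (2 + 4 * 5 ^ enc.dim n k * enc.coordNorm n k)
  Cs n _ := (1 / (8 * C * (ω (ωφ n (Metric.diam (D.feat n)).toNNReal) + 1))) ^ p / 2
  Cd_pos _ := by positivity
  CN_pos _ := one_pos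
  C₂_pos n k := by
    have := enc.radius_pos n k
    positivity
  C₃_pos _ _ := by positivity
  A_pos _ _ := by positivity
  Cs_pos _ _ := by positivity

theorem FeatureDecomposition.isCompact_core (hK : IsCompact μ.support) {n : ℕ}
    (hn : (n : ℕ∞) < D.N) : IsCompact (D.core n) := hK.inter_left (D.isClosed n hn)

theorem FeatureDecomposition.isCompact_feat (hK : IsCompact μ.support) {n : ℕ}
    (hn : (n : ℕ∞) < D.N) : IsCompact (D.feat n) :=
  (D.isCompact_core hK hn).image_of_continuousOn
    ((D.continuousOn n hn).mono inter_subset_left)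

theorem BAPEncoding.isCompact_encode (enc : BAPEncoding D) (hK : IsCompact μ.support) {n : ℕ}
    (hn : (n : ℕ∞) < D.N) (k : ℕ) : IsCompact (enc.encode n k '' D.core n) := by
  have := enc.finiteDimensional_range n k
  refine (D.isCompact_core hK hn).image_of_continuousOn ?_
  have h1 : ContinuousOn (fun x => enc.T n k (D.φ n x)) (D.core n) :=
    (enc.T n k).continuous.comp_continuousOn ((D.continuousOn n hn).mono inter_subset_left)
  have h2 : Continuous (enc.ι n k).symm :=
    (enc.ι n k).symm.toLinearMap.continuous_of_finiteDimensional
  exact h2.comp_continuousOn (continuousOn_iff_continuous_domRestrict.2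
    (Continuous.subtype_mk (continuousOn_iff_continuous_domRestrict.1 h1) _))

theorem BAPEncoding.coord_encode (enc : BAPEncoding D) (n k : ℕ) (x : X) :
    (enc.ι n k (enc.encode n k x) : D.F n) = enc.T n k (D.φ n x) := by
  rw [BAPEncoding.encode, LinearEquiv.apply_symm_apply]

/-- Uniform convergence makes the set of admissible indices nonempty, so the infimum is attained and
is not a default value. The same point matters for `rateInv_spec`, where the rate tends to 0. -/
theorem BAPEncoding.norm_bapIndex_le (enc : BAPEncoding D) {n : ℕ} (hn : (n : ℕ∞) < D.N)
    {ε : ℝ≥0} (hε : 0 < ε) {u : D.F n} (hu : u ∈ D.feat n) :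
    ‖enc.T n (bapIndex (enc.T n) (D.feat n) ε) u - u‖ ≤ ε := by
  obtain ⟨C, -, -, -, hT⟩ := enc.realizes n hn
  have hne : {k | ∀ u ∈ D.feat n, ‖enc.T n k u - u‖ ≤ ε}.Nonempty := by
    obtain ⟨k, hk⟩ := (Metric.tendstoUniformlyOn_iff.1 hT ε (NNReal.coe_pos.2 hε)).exists
    refine ⟨k, fun u hu => ?_⟩
    rw [← dist_eq_norm, dist_comm]
    exact (hk u hu).le
  exact Nat.sInf_mem hne u hu

theorem UniversalApproximator.rateInv_spec (𝓕 : UniversalApproximator) {d m : ℕ} (hd : 1 ≤ d)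
    (hm : 1 ≤ m) {Ω : ℝ≥0 → ℝ≥0} (hc : Continuous Ω) (hmono : Monotone Ω) (h0 : Ω 0 = 0)
    {s : Set (Euc d)} (hs : s.Nonempty) (hs' : IsCompact s) {t : ℝ≥0} (ht : 0 < t) :
    1 ≤ 𝓕.rateInv Ω d s m t ∧ 𝓕.rate Ω d s m (𝓕.rateInv Ω d s m t) ≤ t := by
  have hne : {c | 1 ≤ c ∧ 𝓕.rate Ω d s m c ≤ t}.Nonempty := by
    obtain ⟨c, hc1, hc2⟩ := ((eventually_ge_atTop 1).and
      ((𝓕.rate_tendsto d m hd hm Ω hc hmono h0 s hs hs').eventually_lt_const ht)).exists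
    exact ⟨c, hc1, hc2.le⟩
  exact Nat.sInf_mem hne

/-- Over a subset `A` of a part, there is a net of points of `A` with weights, realized by the
universal approximator within the parameter bounds, which are concentrated near the argument. -/
theorem exists_local_weights (hK : IsCompact μ.support) (enc : BAPEncoding D)
    {ω : ℝ≥0 → ℝ≥0} {ωφ : ℕ → ℝ≥0 → ℝ≥0} (hω : IsHolderLikeModulus ω) {n : ℕ}
    (hn : (n : ℕ∞) < D.N) (hωφ : IsHolderLikeModulus (ωφ n)) (𝓕 : UniversalApproximator)
    {C : ℝ≥0} (hC : 0 < C) (p : ℕ) {A : Set X} (hA : A ⊆ D.core n) (hAne : A.Nonempty)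
    {εd εN εc : ℝ≥0} (hεd : 0 < εd) (hεN : 0 < εN) (hεc : 0 < εc) (p' : ℕ) :
    ∃ (k N c : ℕ) (F : Euc (enc.dim n k) → Euc N) (x : Fin N → X),
      1 ≤ N ∧ 1 ≤ c ∧ F ∈ 𝓕.fam (enc.dim n k) N c ∧ (∀ i, x i ∈ A) ∧
      ParamBounds enc ω ωφ 𝓕 (rateConstants enc ω ωφ C hC p) n k N c εd εN εc p' ∧
      ∀ y ∈ A, ∃ far : Finset (Fin N), (∃ i, i ∉ far) ∧
        (∀ i ∉ far, ω (ωφ n (nndist (D.φ n y) (D.φ n (x i)))) ≤ (εd + εN + εc) / (24 * C)) ∧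
        ∑ i ∈ far, simplexProj (F (enc.encode n k y)) i ≤
          2 * (rateConstants enc ω ωφ C hC p).Cs n k * εc ^ p' := by
  classical
  set B := rateConstants enc ω ωφ C hC p with hB
  have hΩ := hω.comp hωφ
  set Ω : ℝ≥0 → ℝ≥0 := fun t => ω (ωφ n t) with hΩdef
  -- the encoding index
  set ε' := genInv (ωφ n) (genInv ω (εd / B.Cd n)) with hε'
  have hε'Ω : Ω ε' = εd / B.Cd n := by
    rw [hε', hω.genInv_comp hωφ, hΩ.apply_genInv]
  have hε'pos : 0 < ε' := hωφ.genInv_pos (hω.genInv_pos (div_pos hεd (B.Cd_pos n)))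
  set k := bapIndex (enc.T n) (D.feat n) ε' with hk
  have hbap : ∀ u ∈ D.feat n, ‖enc.T n k u - u‖ ≤ ε' := fun u hu =>
    enc.norm_bapIndex_le hn hε'pos hu
  -- the scale of the net
  set s := genInv Ω ((εc + εN) / (48 * C)) with hs
  have hsΩ : Ω s = (εc + εN) / (48 * C) := hΩ.apply_genInv _
  have hspos : 0 < s := hΩ.genInv_pos (by positivity)
  -- The net has scale `s`, large enough for a modulus controlled by `εc`. Its size is bounded
  -- through the finer scale `sN ≤ s`, because the bound on `N` may involve only `εN`.
  set sN := genInv Ω (B.C₃ n k * εN) with hsN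
  have hsNpos : 0 < sN := hΩ.genInv_pos (mul_pos (B.C₃_pos n k) hεN)
  have hsNs : sN ≤ s := by
    rw [← hΩ.strictMono.le_iff_le, hsN, hΩ.apply_genInv, hsΩ]
    change 1 / (48 * C) * εN ≤ _
    rw [one_div_mul_eq_div]
    gcongr
    exact le_add_self
  have hfin := enc.finiteDimensional_range n k
  set V := LinearMap.range (enc.T n k : D.F n →ₗ[ℝ] D.F n) with hV
  have hTcpt : IsCompact (enc.T n k '' D.feat n) :=
    (D.isCompact_feat hK hn).image (enc.T n k).continuous
  have hdoub : IsDoublingWith (enc.T n k '' D.feat n) (doublingConst (enc.T n k '' D.feat n)) :=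
    (isDoubling_of_subset_submodule V _ (by
      rintro _ ⟨u, -, rfl⟩
      exact ⟨u, rfl⟩)).doublingConst_spec
  set K := doublingConst (enc.T n k '' D.feat n) with hKdef
  set j := ⌈-Real.logb 2 (B.C₂ n k * sN)⌉₊ with hj
  obtain ⟨x₀, hx₀⟩ := hAne
  have hmemT : ∀ x ∈ A, enc.T n k (D.φ n x) ∈ enc.T n k '' D.feat n := fun x hx =>
    mem_image_of_mem _ (mem_image_of_mem _ (hA hx))
  have hball : enc.T n k '' D.feat n ⊆
      Metric.ball (enc.T n k (D.φ n x₀)) (enc.radius n k) := by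
    intro v hv
    rw [Metric.mem_ball]
    refine (Metric.dist_le_diam_of_mem hTcpt.isBounded hv (hmemT x₀ hx₀)).trans_lt ?_
    rw [BAPEncoding.radius, NNReal.coe_add, Real.coe_toNNReal _ Metric.diam_nonneg]
    simp
  have hR : 0 < (enc.radius n k : ℝ) := enc.radius_pos n k
  have hjs : 2 * (enc.radius n k : ℝ) ≤ 2 ^ j * s := by
    have hpos : 0 < (B.C₂ n k : ℝ) * sN := mul_pos (B.C₂_pos n k) hsNpos
    have h1 : -Real.logb 2 (B.C₂ n k * sN) ≤ j := Nat.le_ceil _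
    rw [← Real.logb_inv, Real.logb_le_iff_le_rpow (by norm_num) (inv_pos.2 hpos),
      Real.rpow_natCast, inv_le_iff_one_le_mul₀ hpos] at h1
    have h2 : (B.C₂ n k : ℝ) = 1 / (2 * enc.radius n k) := by
      rw [hB]
      simp [rateConstants]
    rw [h2, ← mul_assoc, mul_one_div, div_mul_eq_mul_div, le_div_iff₀ (by positivity), one_mul] at h1
    refine h1.trans ?_
    gcongr
  -- Nodes come from points of `A`, but are counted in the image of all of `D.feat n`, whose
  -- doubling constant enters the bound.
  have hcount : ∀ t : Finset V, (t : Set V) ⊆ {v | ∃ x ∈ A, (v : D.F n) = enc.T n k (D.φ n x)} →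
      (∀ v ∈ t, ∀ w ∈ t, v ≠ w → (s : ℝ) ≤ dist v w) → t.card ≤ K ^ j := by
    intro t ht hsep
    rw [← Finset.card_image_of_injective t (Subtype.val_injective)]
    refine hdoub.card_le (hmemT x₀ hx₀) hR hball hjs _ ?_ ?_
    · intro v hv
      obtain ⟨v', hv', rfl⟩ := Finset.mem_image.1 (Finset.mem_coe.1 hv)
      obtain ⟨x, hx, hvx⟩ := ht hv'
      rw [hvx]
      exact hmemT x hx
    · intro v hv w hw hvw
      obtain ⟨v', hv', rfl⟩ := Finset.mem_image.1 hv
      obtain ⟨w', hw', rfl⟩ := Finset.mem_image.1 hw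
      exact hsep v' hv' w' hw' fun h => hvw (by rw [h])
  obtain ⟨t, htA, hsep, hcov⟩ := exists_maximal_separated _ _ _ hcount
  have hcov := hcov (NNReal.coe_pos.2 hspos)
  set N := t.card with hN
  set q : Fin N → V := fun i => (t.equivFin.symm i : V) with hq
  have hqsep : ∀ i j, i ≠ j → (s : ℝ) ≤ dist (q i) (q j) := fun i j hij =>
    hsep _ (t.equivFin.symm i).2 _ (t.equivFin.symm j).2
      fun h => hij (t.equivFin.symm.injective (Subtype.ext h))
  have hqcov : ∀ x ∈ A, ∃ i, dist (enc.ι n k (enc.encode n k x)) (q i) < s := by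
    intro x hx
    obtain ⟨v, hv, hxv⟩ := hcov (enc.ι n k (enc.encode n k x)) ⟨x, hx, enc.coord_encode n k x⟩
    exact ⟨t.equivFin ⟨v, hv⟩, by simpa [hq] using hxv⟩
  choose x hxA hxq using fun i => htA (t.equivFin.symm i).2
  have hN1 : 1 ≤ N := by
    obtain ⟨i, -⟩ := hqcov x₀ hx₀
    exact i.pos
  have hd1 : 1 ≤ enc.dim n k := enc.dim_pos n k hn
  -- the approximator
  set f : Euc (enc.dim n k) → Euc N := fun u => netWeights s q (enc.ι n k u) with hf
  set Ω' : ℝ≥0 → ℝ≥0 := fun t => B.A n k / εc * ω (ωφ n t) with hΩ'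
  have hΩ'c : Continuous Ω' := continuous_const.mul hΩ.continuous
  have hΩ'm : Monotone Ω' := fun a b hab => by
    change B.A n k / εc * Ω a ≤ B.A n k / εc * Ω b
    gcongr
    exact hΩ.strictMono.monotone hab
  have hΩ'0 : Ω' 0 = 0 := by
    change B.A n k / εc * Ω 0 = 0
    rw [hΩ.map_zero, mul_zero]
  have hfmod : ∀ u u', nndist (f u) (f u') ≤ Ω' (nndist u u') := by
    intro u u'
    have h := norm_netWeights_sub_le_modulus hspos q hqsep hΩ (enc.dist_coord_le n k u u')
    rw [enc.finrank_range, hsΩ] at h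
    have h1 : nndist (f u) (f u') * ((εc + εN) / (48 * C)) ≤
        2 * (2 + 4 * 5 ^ enc.dim n k * enc.coordNorm n k) * Ω (nndist u u') := by
      rw [← NNReal.coe_le_coe]
      push_cast
      rw [dist_eq_norm]
      exact_mod_cast h
    -- Dropping `εN` from `Ω s` leaves a modulus that depends on `εc` only, as in the bound on `c`.
    have h2 : nndist (f u) (f u') * (εc / (48 * C)) ≤
        2 * (2 + 4 * 5 ^ enc.dim n k * enc.coordNorm n k) * Ω (nndist u u') := by
      refine le_trans ?_ h1
      gcongr
      exact le_self_add
    rw [← le_div_iff₀ (by positivity)] at h2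
    refine h2.trans (le_of_eq ?_)
    change _ = 96 * C * (2 + 4 * 5 ^ enc.dim n k * enc.coordNorm n k) / εc * Ω (nndist u u')
    rw [div_div_eq_mul_div, div_mul_eq_mul_div]
    congr 1
    ring
  have hcore : (enc.encode n k '' D.core n).Nonempty := ⟨_, mem_image_of_mem _ (hA hx₀)⟩
  have hcpt := enc.isCompact_encode hK hn k
  have hNpos : 0 < NNReal.sqrt N := by
    rw [NNReal.sqrt_pos]
    exact_mod_cast hN1
  have htol : 0 < B.Cs n k * εc ^ p' / NNReal.sqrt N :=
    div_pos (mul_pos (B.Cs_pos n k) (pow_pos hεc _)) hNpos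
  obtain ⟨hc1, hc2⟩ := 𝓕.rateInv_spec hd1 hN1 hΩ'c hΩ'm hΩ'0 hcore hcpt htol
  set c := 𝓕.rateInv Ω' (enc.dim n k) (enc.encode n k '' D.core n) N
    (B.Cs n k * εc ^ p' / NNReal.sqrt N) with hc
  obtain ⟨F, hF, hFf⟩ := 𝓕.approx _ _ hd1 hN1 f Ω' hΩ'c hΩ'm hΩ'0 hfmod _ hcore hcpt c hc1
  refine ⟨k, N, c, F, x, hN1, hc1, hF, hxA, ⟨le_rfl, ?_, le_rfl⟩, fun y hy => ?_⟩
  · have hNK : N ≤ K ^ j := hcount t htA hsep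
    have h1 : Real.log N ≤ Real.log ((K : ℝ) ^ j) :=
      Real.log_le_log (by exact_mod_cast hN1) (by exact_mod_cast hNK)
    rw [Real.log_pow] at h1
    refine h1.trans (le_of_eq ?_)
    change _ = ((1 : ℝ≥0) : ℝ) * Real.log K * j
    rw [NNReal.coe_one]
    ring
  · have hwS : (netWeights (s : ℝ) q (enc.ι n k (enc.encode n k y))).ofLp ∈ stdSimplex ℝ (Fin N) :=
      netWeights_mem_stdSimplex hspos q (hqcov y hy)
    -- Far nodes are those of zero exact weight. Not all nodes are far, since the exact weights sum
    -- to 1.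
    refine ⟨Finset.univ.filter fun i => netWeights (s : ℝ) q (enc.ι n k (enc.encode n k y)) i = 0,
      ?_, fun i hi => ?_, ?_⟩
    · by_contra! h
      have h0 : ∑ i, netWeights (s : ℝ) q (enc.ι n k (enc.encode n k y)) i = 0 :=
        Finset.sum_eq_zero fun i _ => (Finset.mem_filter.1 (h i)).2
      exact zero_ne_one (h0.symm.trans hwS.2)
    · have hdist : dist (enc.ι n k (enc.encode n k y)) (q i) < 2 * s := by
        by_contra! h
        exact hi (Finset.mem_filter.2 ⟨Finset.mem_univ _, netWeights_eq_zero hspos q _ h⟩)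
      rw [Subtype.dist_eq, enc.coord_encode, hxq i] at hdist
      have h1 := hbap _ (mem_image_of_mem _ (hA hy))
      have h2 := hbap _ (mem_image_of_mem _ (hA (hxA i)))
      -- `2 s` is the width of the hat; `T` displaces each of the two features by at most `ε'`.
      have h3 : nndist (D.φ n y) (D.φ n (x i)) ≤ 2 * s + 2 * ε' := by
        rw [← NNReal.coe_le_coe, coe_nndist]
        push_cast
        have h4 := dist_triangle4 (D.φ n y) (enc.T n k (D.φ n y)) (enc.T n k (D.φ n (x i)))
          (D.φ n (x i))
        rw [dist_comm (D.φ n y) (enc.T n k (D.φ n y)), dist_eq_norm (enc.T n k (D.φ n y)) (D.φ n y),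
          dist_eq_norm (enc.T n k (D.φ n (x i))) (D.φ n (x i))] at h4
        linarith
      calc Ω (nndist (D.φ n y) (D.φ n (x i))) ≤ Ω (2 * s + 2 * ε') := hΩ.strictMono.monotone h3
        _ ≤ 2 * Ω s + 2 * Ω ε' := (hΩ.subadditive _ _).trans
            (add_le_add (hΩ.map_two_mul_le _) (hΩ.map_two_mul_le _))
        _ = (εd + εN + εc) / (24 * C) := by
            rw [hsΩ, hε'Ω]
            change 2 * ((εc + εN) / (48 * C)) + 2 * (εd / (48 * C)) = _
            field_simp
            ring
    · set w := f (enc.encode n k y) with hw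
      set v := F (enc.encode n k y) with hv
      have hwv : ‖w - v‖ ≤ B.Cs n k * εc ^ p' / √N := by
        refine (hFf _ (mem_image_of_mem _ (hA hy))).trans ?_
        simpa using NNReal.coe_le_coe.2 hc2
      exact sum_simplexProj_filter_le hN1 v w hwS hwv

end Encoding

/-! ### Mixing and quantization -/

namespace QAS

variable {Y : Type*} [MetricSpace Y] (𝒜 : QAS Y)

theorem Q_mono {q q' : ℕ} (h : q ≤ q') (z : Fin (𝒜.D q) → ℝ) : ∃ z', 𝒜.Q q z = 𝒜.Q q' z' := by
  induction q', h using Nat.le_induction with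
  | base => exact ⟨z, rfl⟩
  | succ k _ ih =>
    obtain ⟨z', hz'⟩ := ih
    obtain ⟨z'', hz''⟩ := 𝒜.nested k z'
    exact ⟨z'', hz'.trans hz''⟩

theorem pair_mem_stdSimplex {δ : ℝ} (hδ : δ ∈ Icc (0 : ℝ) 1) :
    ![1 - δ, δ] ∈ stdSimplex ℝ (Fin 2) := by
  refine ⟨fun i => ?_, by simp⟩
  fin_cases i
  · simpa using hδ.2
  · simpa using hδ.1

theorem IsEtaConvex.retract_subset {𝒜 : QAS Y} {A : Set Y} (hA : 𝒜.IsEtaConvex A) {b : Y}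
    (hb : b ∈ A) {δ : ℝ} (hδ : δ ∈ Icc (0 : ℝ) 1) : 𝒜.retract A b δ ⊆ A := by
  rintro _ ⟨a, ha, rfl⟩
  refine hA 2 one_le_two _ (pair_mem_stdSimplex hδ) _ fun i => ?_
  fin_cases i
  · exact hb
  · exact ha

theorem dist_eta_pair_le {δ : ℝ} (hδ : δ ∈ Icc (0 : ℝ) 1) (b a : Y) :
    dist (𝒜.eta 2 ![1 - δ, δ] ![b, a]) a ≤
      𝒜.Cη * (dist a b ^ 𝒜.p * (1 - δ)) ^ (1 / (𝒜.p : ℝ)) := by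
  have hp : 𝒜.p ≠ 0 := by have := 𝒜.one_le_p; omega
  have := 𝒜.mixing 2 _ (pair_mem_stdSimplex hδ) ![b, a] 1
  simpa [Fin.sum_univ_two, hp] using this

theorem tendsto_eta_pair (b a : Y) :
    Tendsto (fun δ : ℝ => 𝒜.eta 2 ![1 - δ, δ] ![b, a]) (𝓝[<] 1) (𝓝 a) := by
  have hp : 0 < 1 / (𝒜.p : ℝ) := by
    have := 𝒜.one_le_p
    positivity
  rw [tendsto_iff_dist_tendsto_zero]
  have h1 : Tendsto (fun δ : ℝ => 𝒜.Cη * (dist a b ^ 𝒜.p * (1 - δ)) ^ (1 / (𝒜.p : ℝ)))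
      (𝓝[<] 1) (𝓝 0) := by
    have hc : Continuous fun δ : ℝ => 𝒜.Cη * (dist a b ^ 𝒜.p * (1 - δ)) ^ (1 / (𝒜.p : ℝ)) :=
      continuous_const.mul ((by fun_prop : Continuous fun δ : ℝ => dist a b ^ 𝒜.p * (1 - δ)).rpow_const
        fun _ => Or.inr hp.le)
    have := (hc.tendsto 1).mono_left (nhdsWithin_le_nhds (s := Iio 1))
    simpa [Real.zero_rpow (one_div (𝒜.p : ℝ) ▸ hp.ne')] using this
  refine squeeze_zero' (Eventually.of_forall fun _ => dist_nonneg) ?_ h1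
  filter_upwards [Ioo_mem_nhdsLT (zero_lt_one (α := ℝ))] with δ hδ
  exact 𝒜.dist_eta_pair_le ⟨hδ.1.le, hδ.2.le⟩ b a

/-- The error of mixing quantized points, when the weights far from the target are small. -/
theorem dist_eta_le {N : ℕ} {w : Fin N → ℝ} (hw : w ∈ stdSimplex ℝ (Fin N)) {y u : Fin N → Y}
    {v : Y} {e ρ b κ : ℝ} (he : 0 ≤ e) (hρ : 0 ≤ ρ) (hb : 0 ≤ b)
    (hu : ∀ i, dist (y i) (u i) ≤ e) (hy : ∀ i j, dist (y i) (y j) ≤ b) (far : Finset (Fin N))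
    (hne : ∃ i, i ∉ far) (hnear : ∀ i ∉ far, dist v (y i) ≤ ρ) (hfar : ∑ i ∈ far, w i ≤ κ) :
    dist (𝒜.eta N w u) v ≤ 𝒜.Cη * (2 * ρ + 2 * e + b * κ ^ (1 / (𝒜.p : ℝ))) + (e + ρ) := by
  obtain ⟨i, hi⟩ := hne
  -- The mixing inequality is centred at a node that is not far, so the other near nodes lie within
  -- `2 ρ + 2 e` of it.
  have h1 := 𝒜.mixing N w hw u i
  have h2 : ∀ j, dist (u i) (u j) ≤ dist (y i) (y j) + 2 * e := fun j => by
    have := dist_triangle4 (u i) (y i) (y j) (u j)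
    rw [dist_comm (u i) (y i)] at this
    linarith [hu i, hu j]
  have h3 : (∑ j, dist (u i) (u j) ^ 𝒜.p * w j) ^ (1 / (𝒜.p : ℝ)) ≤
      2 * ρ + 2 * e + b * κ ^ (1 / (𝒜.p : ℝ)) := by
    refine weighted_mean_le hw 𝒜.one_le_p (fun _ => dist_nonneg) far (by positivity) hb
      (fun j hj => (h2 j).trans ?_) (fun j _ => (h2 j).trans ?_) hfar
    · have := dist_triangle_left (y i) (y j) v
      linarith [hnear i hi, hnear j hj]
    · linarith [hy i j]
  have h4 : (𝒜.Cη : ℝ) * (∑ j, dist (u i) (u j) ^ 𝒜.p * w j) ^ (1 / (𝒜.p : ℝ)) ≤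
      𝒜.Cη * (2 * ρ + 2 * e + b * κ ^ (1 / (𝒜.p : ℝ))) := by gcongr
  have h5 := dist_triangle4 (𝒜.eta N w u) (u i) (y i) v
  rw [dist_comm (u i) (y i), dist_comm (y i) v] at h5
  linarith [hu i, hnear i hi]

end QAS

namespace IsQuantizedGeodesicPartition

variable {Y : Type*} [MetricSpace Y] [MeasurableSpace Y] [BorelSpace Y] {𝒜 : QAS Y} {M : ℕ}
  {part : Fin M → Set Y} {base : Fin M → Y} {S : ℝ → ℝ}

theorem retract_subset (h : IsQuantizedGeodesicPartition 𝒜 part base S) (m : Fin M) {δ : ℝ}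
    (hδ : δ ∈ Icc (0 : ℝ) 1) : 𝒜.retract (part m) (base m) δ ⊆ part m :=
  (h.etaConvex m).retract_subset (h.base_mem m) hδ

/-- Points which lie in no other part are interior points of their part. -/
theorem isOpen_compl_iUnion (h : IsQuantizedGeodesicPartition 𝒜 part base S) (m : Fin M) :
    IsOpen (⋃ m', ⋃ _ : m' ≠ m, part m')ᶜ :=
  (isClosed_iUnion_of_finite fun m' => isClosed_iUnion_of_finite fun _ => h.isClosed m').isOpen_compl

theorem compl_iUnion_subset (h : IsQuantizedGeodesicPartition 𝒜 part base S) (m : Fin M) :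
    (⋃ m', ⋃ _ : m' ≠ m, part m')ᶜ ⊆ part m := by
  intro y hy
  obtain ⟨m', hm'⟩ := mem_iUnion.1 (h.cover.symm ▸ mem_univ y : y ∈ ⋃ m, part m)
  by_cases hmm : m' = m
  · exact hmm ▸ hm'
  · exact absurd (mem_iUnion₂.2 ⟨m', hmm, hm'⟩) hy

theorem retract_subset_compl (h : IsQuantizedGeodesicPartition 𝒜 part base S) (m : Fin M) {δ : ℝ}
    (h0 : 0 ≤ δ) (h1 : δ < 1) :
    𝒜.retract (part m) (base m) δ ⊆ (⋃ m', ⋃ _ : m' ≠ m, part m')ᶜ := by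
  intro y hy hy'
  obtain ⟨m', hm', hym'⟩ := mem_iUnion₂.1 hy'
  have := h.disjoint m m' hm'.symm δ h0 h1
  exact (this.le ⟨hy, hym'⟩ : y ∈ (∅ : Set Y))

/-- A quantized point close to `y` may fall into another part. Contracting `y` slightly towards the
base point gives a point with a neighbourhood inside the part, and density is applied there. -/
theorem exists_quantized_near (h : IsQuantizedGeodesicPartition 𝒜 part base S) (m : Fin M) {y : Y}
    (hy : y ∈ part m) {ε : ℝ} (hε : 0 < ε) :
    ∃ q z, 𝒜.Q q z ∈ part m ∧ dist y (𝒜.Q q z) < ε := by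
  obtain ⟨δ, hδ, hδy⟩ := ((Filter.eventually_mem_set.2 (Ioo_mem_nhdsLT (zero_lt_one (α := ℝ)))).and
    ((𝒜.tendsto_eta_pair (base m) y).eventually (Metric.ball_mem_nhds y (half_pos hε)))).exists
  obtain ⟨r, hr, hball⟩ := Metric.isOpen_iff.1 (h.isOpen_compl_iUnion m) _
    (h.retract_subset_compl m hδ.1.le hδ.2 ⟨y, hy, rfl⟩)
  obtain ⟨q, z, hqz⟩ := 𝒜.dense (𝒜.eta 2 ![1 - δ, δ] ![base m, y]) (min r (ε / 2))
    (lt_min hr (half_pos hε))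
  refine ⟨q, z, h.compl_iUnion_subset m (hball ?_), ?_⟩
  · rw [Metric.mem_ball, dist_comm]
    exact hqz.trans_le (min_le_left _ _)
  · have h1 := dist_triangle_left y (𝒜.Q q z) (𝒜.eta 2 ![1 - δ, δ] ![base m, y])
    have h2 := hqz.trans_le (min_le_right _ _)
    have h3 : dist (𝒜.eta 2 ![1 - δ, δ] ![base m, y]) y < ε / 2 := hδy
    linarith

/-- The quantization modulus of a compact subset of a part is attained. -/
theorem quantModulus_spec (h : IsQuantizedGeodesicPartition 𝒜 part base S) (m : Fin M)
    {A : Set Y} (hA : IsCompact A) (hAm : A ⊆ part m) {ε : ℝ} (hε : 0 < ε) :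
    ∃ q, 𝒜.D q = 𝒜.quantModulus (part m) A ε ∧
      ∀ y ∈ A, ∃ z, 𝒜.Q q z ∈ part m ∧ dist y (𝒜.Q q z) < ε := by
  have hne : {d | ∃ q, 𝒜.D q = d ∧
      ∀ y ∈ A, ∃ z, 𝒜.Q q z ∈ part m ∧ dist y (𝒜.Q q z) < ε}.Nonempty := by
    -- By compactness finitely many quantized points serve all of `A`, and nestedness lifts them to
    -- the highest of their levels.
    choose! q z hz hdist using fun y (hy : y ∈ A) =>
      h.exists_quantized_near m (hAm hy) (half_pos hε)
    obtain ⟨t, htA, hcov⟩ := hA.elim_nhds_subcover (fun y => Metric.ball y (ε / 2))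
      fun y _ => Metric.ball_mem_nhds y (half_pos hε)
    refine ⟨_, t.sup q, rfl, fun y hy => ?_⟩
    obtain ⟨x, hx, hyx⟩ := mem_iUnion₂.1 (hcov hy)
    obtain ⟨z', hz'⟩ := 𝒜.Q_mono (Finset.le_sup (f := q) hx) (z x)
    refine ⟨z', hz' ▸ hz x (htA x hx), hz' ▸ ?_⟩
    have h1 := dist_triangle y x (𝒜.Q (q x) (z x))
    have h2 := hdist x (htA x hx)
    have h3 : dist y x < ε / 2 := hyx
    linarith
  exact Nat.sInf_mem hne

end IsQuantizedGeodesicPartition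

/-- Supplies a member of the family over parts that miss the support, where no estimate is required.
-/
theorem UniversalApproximator.fam_nonempty (𝓕 : UniversalApproximator) {d m : ℕ} (hd : 1 ≤ d)
    (hm : 1 ≤ m) : (𝓕.fam d m 1).Nonempty := by
  obtain ⟨g, hg, -⟩ := 𝓕.approx d m hd hm (fun _ => 0) id continuous_id monotone_id rfl
    (fun x y => by simp) {0} (singleton_nonempty _) isCompact_singleton 1 le_rfl
  exact ⟨g, hg⟩

/-! ### Local parameters of the model -/

section Local

variable {X : Type*} [MetricSpace X] {Y : Type*} [MetricSpace Y]
  {ω : ℝ≥0 → ℝ≥0} {ωφ : ℕ → ℝ≥0 → ℝ≥0} {f : X → Y} {n : ℕ}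

theorem IsHolderLike.continuous (hf : IsHolderLike ω f) : Continuous f := by
  rw [continuous_iff_continuousAt]
  intro x
  rw [ContinuousAt, tendsto_iff_dist_tendsto_zero]
  have h1 : Tendsto (fun y => (ω (nndist y x) : ℝ)) (𝓝 x) (𝓝 0) := by
    have hc : Continuous fun y => (ω (nndist y x) : ℝ) :=
      NNReal.continuous_coe.comp (hf.1.continuous.comp (continuous_id.nndist continuous_const))
    simpa [hf.1.map_zero] using hc.tendsto x
  refine squeeze_zero (fun _ => dist_nonneg) (fun y => ?_) h1
  exact_mod_cast hf.2 y x

variable [MeasurableSpace X] {μ : Measure X} {D : FeatureDecomposition X μ}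

theorem IsHolderLike.nndist_le_feature (hf : IsHolderLike ω f)
    (hωφ : ∀ x ∈ D.core n, ∀ y ∈ D.core n, nndist x y ≤ ωφ n (nndist (D.φ n x) (D.φ n y)))
    {x y : X} (hx : x ∈ D.core n) (hy : y ∈ D.core n) :
    nndist (f x) (f y) ≤ ω (ωφ n (nndist (D.φ n x) (D.φ n y))) :=
  (hf.2 x y).trans (hf.1.strictMono.monotone (hωφ x hx y hy))

theorem IsHolderLike.nndist_le_diam (hf : IsHolderLike ω f) (hK : IsCompact μ.support)
    (hn : (n : ℕ∞) < D.N) (hωφ' : IsHolderLikeModulus (ωφ n))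
    (hωφ : ∀ x ∈ D.core n, ∀ y ∈ D.core n, nndist x y ≤ ωφ n (nndist (D.φ n x) (D.φ n y)))
    {x y : X} (hx : x ∈ D.core n) (hy : y ∈ D.core n) :
    nndist (f x) (f y) ≤ ω (ωφ n (Metric.diam (D.feat n)).toNNReal) := by
  refine (hf.nndist_le_feature hωφ hx hy).trans
    ((hf.1.comp hωφ').strictMono.monotone ?_)
  rw [← NNReal.coe_le_coe, coe_nndist, Real.coe_toNNReal _ Metric.diam_nonneg]
  exact Metric.dist_le_diam_of_mem (D.isCompact_feat hK hn).isBounded (mem_image_of_mem _ hx)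
    (mem_image_of_mem _ hy)

/-- The constant of the tolerance makes the contribution of far points small. -/
theorem diam_mul_tolerance_rpow_le {b C ε : ℝ} (hb : 0 ≤ b) (hC : 0 < C) (hε : 0 ≤ ε) {p : ℕ}
    (hp : 1 ≤ p) :
    b * (2 * ((1 / (8 * C * (b + 1))) ^ p / 2) * ε ^ p) ^ (1 / (p : ℝ)) ≤ ε / (8 * C) := by
  have h1 : 2 * ((1 / (8 * C * (b + 1))) ^ p / 2) * ε ^ p = (ε / (8 * C * (b + 1))) ^ p := by
    rw [mul_div_cancel₀ _ two_ne_zero, ← mul_pow, one_div_mul_eq_div]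
  rw [h1, one_div, Real.pow_rpow_inv_natCast (by positivity) (by omega), mul_div_assoc',
    div_le_div_iff₀ (by positivity) (by positivity)]
  have : 0 ≤ ε * C := by positivity
  nlinarith

variable {M : ℕ}

/-- Local parameters of the approximate partition of `Y`: the local part of `Ĉ_m` recognizes the
region `E m` among separated regions. -/
theorem exists_local_classifier (hK : IsCompact μ.support) (enc : BAPEncoding D)
    (hf : IsHolderLike ω f) (hn : (n : ℕ∞) < D.N) (hωφ' : IsHolderLikeModulus (ωφ n))
    (hωφ : ∀ x ∈ D.core n, ∀ y ∈ D.core n, nndist x y ≤ ωφ n (nndist (D.φ n x) (D.φ n y)))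
    (𝒜 : QAS Y) (𝓕 : UniversalApproximator) (hC : 0 < 𝒜.Cη) {εA σ : ℝ≥0} (hA : 0 < εA)
    (hσ : 0 < σ) (hσ2 : σ ≤ 1 / 2) (E : Fin M → Set Y)
    (hE : ∀ m m', m ≠ m' → ∀ y ∈ E m, ∀ y' ∈ E m', 3 * (σ : ℝ) ≤ dist y y') (m : Fin M) :
    ∃ (k N c : ℕ) (z : Fin N → ℝ) (F : Euc (enc.dim n k) → Euc N),
      1 ≤ N ∧ 1 ≤ c ∧ F ∈ 𝓕.fam (enc.dim n k) N c ∧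
      ((D.core n).Nonempty →
        ParamBounds enc ω ωφ 𝓕 (rateConstants enc ω ωφ 𝒜.Cη hC 𝒜.p) n k N c σ σ σ 1) ∧
      ∀ x ∈ D.core n, ∀ m', f x ∈ E m' →
        (∑ i, simplexProj (F (enc.encode n k x)) i * |z i| ≤ εA / 4 ↔ m' = m) := by
  classical
  have hC1 : (1 : ℝ) ≤ 𝒜.Cη := 𝒜.one_le_Cη
  have hA' : (0 : ℝ) < εA := hA
  have hσ' : (0 : ℝ) < σ := hσ
  have hσ2' : (σ : ℝ) ≤ 1 / 2 := by exact_mod_cast hσ2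
  rcases (D.core n).eq_empty_or_nonempty with hempty | hne
  · obtain ⟨F, hF⟩ := 𝓕.fam_nonempty (enc.dim_pos n 0 hn) le_rfl
    refine ⟨0, 1, 1, 0, F, le_rfl, le_rfl, hF, fun h => ?_, fun x hx => ?_⟩
    · simp [hempty] at h
    · simp [hempty] at hx
  obtain ⟨k, N, c, F, x, hN, hc, hF, hxA, hB, hw⟩ := exists_local_weights hK enc hf.1 hn hωφ' 𝓕
    hC 𝒜.p subset_rfl hne hσ hσ hσ 1
  -- Labels `0` near `E m` and `εA / 2` elsewhere put the threshold `εA / 4` halfway.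
  let z : Fin N → ℝ := fun i => if ∃ y ∈ E m, dist (f (x i)) y ≤ σ then 0 else εA / 2
  have hz0 : ∀ i, 0 ≤ z i := fun i => by dsimp only [z]; split_ifs <;> positivity
  have hzle : ∀ i, z i ≤ εA / 2 := fun i => by dsimp only [z]; split_ifs <;> [positivity; rfl]
  refine ⟨k, N, c, z, F, hN, hc, hF, fun _ => hB, fun y hy m' hym' => ?_⟩
  obtain ⟨hs0, hs1⟩ := (simplexProj_spec hN (F (enc.encode n k y))).1
  set w := simplexProj (F (enc.encode n k y)) with hwdef
  obtain ⟨far, -, hnear, hsum⟩ := hw y hy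
  -- All three scales equal `σ`, so the radius is `3 σ / (24 Cη) ≤ σ / 8`.
  have hnear' : ∀ i ∉ far, dist (f y) (f (x i)) ≤ σ / 8 := fun i hi => by
    have := (hf.nndist_le_feature hωφ hy (hxA i)).trans (hnear i hi)
    rw [← NNReal.coe_le_coe] at this
    push_cast at this
    refine this.trans ?_
    rw [div_le_div_iff₀ (by positivity) (by norm_num)]
    nlinarith
  have hCs : ((rateConstants enc ω ωφ 𝒜.Cη hC 𝒜.p).Cs n k : ℝ) ≤ 1 / 16 := by
    have h0 : ((rateConstants enc ω ωφ 𝒜.Cη hC 𝒜.p).Cs n k : ℝ) =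
        (1 / (8 * 𝒜.Cη * ((ω (ωφ n (Metric.diam (D.feat n)).toNNReal) : ℝ) + 1))) ^ 𝒜.p / 2 := by
      simp [rateConstants]
    set b : ℝ := ((ω (ωφ n (Metric.diam (D.feat n)).toNNReal) : ℝ≥0) : ℝ) with hb
    have hb0 : 0 ≤ b := by positivity
    have h1 : 1 / (8 * 𝒜.Cη * (b + 1)) ≤ 1 / 8 := by
      gcongr
      nlinarith
    have h2 : (1 / (8 * 𝒜.Cη * (b + 1))) ^ 𝒜.p ≤ 1 / (8 * 𝒜.Cη * (b + 1)) :=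
      pow_le_of_le_one (by positivity) (h1.trans (by norm_num)) (by have := 𝒜.one_le_p; omega)
    rw [h0]
    linarith
  have hfar : ∑ i ∈ far, w i ≤ 1 / 16 := by
    refine hsum.trans ?_
    rw [pow_one]
    nlinarith
  have hsplit : ∑ i, w i * |z i| = ∑ i ∈ far, w i * z i + ∑ i ∈ farᶜ, w i * z i := by
    rw [Finset.sum_add_sum_compl]
    exact Finset.sum_congr rfl fun i _ => by rw [abs_of_nonneg (hz0 i)]
  have hmass : ∑ i ∈ far, w i + ∑ i ∈ farᶜ, w i = 1 := by rw [Finset.sum_add_sum_compl, hs1]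
  rw [hsplit]
  constructor
  · intro hle
    by_contra hmm
    -- A near node with label 0 would put `f y` within `σ / 8 + σ < 3 σ` of `E m`. So near nodes, of
    -- mass at least `15 / 16`, all carry `εA / 2`, which exceeds the threshold.
    have h1 : ∑ i ∈ farᶜ, w i * z i = (∑ i ∈ farᶜ, w i) * (εA / 2) := by
      rw [Finset.sum_mul]
      refine Finset.sum_congr rfl fun i hi => ?_
      have : ¬ ∃ v ∈ E m, dist (f (x i)) v ≤ σ := by
        rintro ⟨v, hv, hxv⟩
        have h2 := hE m' m hmm _ hym' v hv
        have h3 := dist_triangle (f y) (f (x i)) v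
        have h4 := hnear' i (Finset.mem_compl.1 hi)
        linarith
      dsimp only [z]
      rw [if_neg this]
    have h2 : 0 ≤ ∑ i ∈ far, w i * z i := Finset.sum_nonneg fun i _ => mul_nonneg (hs0 i) (hz0 i)
    nlinarith
  · rintro rfl
    have h1 : ∑ i ∈ farᶜ, w i * z i = 0 := by
      refine Finset.sum_eq_zero fun i hi => ?_
      have : ∃ v ∈ E m', dist (f (x i)) v ≤ σ := by
        refine ⟨f y, hym', ?_⟩
        rw [dist_comm]
        linarith [hnear' i (Finset.mem_compl.1 hi)]
      dsimp only [z]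
      rw [if_pos this, mul_zero]
    have h2 : ∑ i ∈ far, w i * z i ≤ (∑ i ∈ far, w i) * (εA / 2) := by
      rw [Finset.sum_mul]
      exact Finset.sum_le_sum fun i _ => mul_le_mul_of_nonneg_left (hzle i) (hs0 i)
    -- Only far nodes contribute, at most `εA / 32`.
    nlinarith

variable [MeasurableSpace Y] [BorelSpace Y] {𝒜 : QAS Y}
  {part : Fin M → Set Y} {base : Fin M → Y} {S : ℝ → ℝ}

/-- Local parameters of the model: the local map approximates `f` where `f` takes values in the
part `m`. -/
theorem exists_local_map (hK : IsCompact μ.support) (enc : BAPEncoding D) (hf : IsHolderLike ω f)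
    (hn : (n : ℕ∞) < D.N) (hωφ' : IsHolderLikeModulus (ωφ n))
    (hωφ : ∀ x ∈ D.core n, ∀ y ∈ D.core n, nndist x y ≤ ωφ n (nndist (D.φ n x) (D.φ n y)))
    (hpart : IsQuantizedGeodesicPartition 𝒜 part base S) (𝓕 : UniversalApproximator)
    (hC : 0 < 𝒜.Cη) {εA εQ εE : ℝ≥0} (hA : 0 < εA) (hQ : 0 < εQ) (hE : 0 < εE) (m : Fin M) :
    ∃ (k N c q : ℕ) (Z : Fin N → Fin (𝒜.D q) → ℝ) (F : Euc (enc.dim n k) → Euc N),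
      1 ≤ N ∧ 1 ≤ c ∧ F ∈ 𝓕.fam (enc.dim n k) N c ∧
      ((D.core n).Nonempty →
        ParamBounds enc ω ωφ 𝓕 (rateConstants enc ω ωφ 𝒜.Cη hC 𝒜.p) n k N c εE εQ εA 𝒜.p ∧
        𝒜.D q = 𝒜.quantModulus (part m) (f '' D.core n ∩ part m) (εQ / (4 * 𝒜.Cη))) ∧
      ∀ x ∈ D.core n, f x ∈ part m →
        𝒜.etaHat N q (simplexProj (F (enc.encode n k x))) Z ∈ part m ∧
        dist (𝒜.etaHat N q (simplexProj (F (enc.encode n k x))) Z) (f x) ≤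
          (εA + εQ + εE) * (7 / 8) := by
  have hC1 : (1 : ℝ) ≤ 𝒜.Cη := 𝒜.one_le_Cη
  have he : 0 < (εQ : ℝ) / (4 * 𝒜.Cη) := by positivity
  rcases (D.core n).eq_empty_or_nonempty with hempty | hne
  · obtain ⟨F, hF⟩ := 𝓕.fam_nonempty (enc.dim_pos n 0 hn) le_rfl
    refine ⟨0, 1, 1, 0, 0, F, le_rfl, le_rfl, hF, fun h => ?_, fun x hx => ?_⟩
    · simp [hempty] at h
    · simp [hempty] at hx
  obtain ⟨q, hq, hqz⟩ := hpart.quantModulus_spec m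
    (((D.isCompact_core hK hn).image hf.continuous).inter_right (hpart.isClosed m))
    inter_subset_right he
  -- If `f` never takes values in this part, only the parameter bounds are needed, and a net of the
  -- whole core supplies them.
  rcases (D.core n ∩ f ⁻¹' part m).eq_empty_or_nonempty with hempty | hAne
  · obtain ⟨k, N, c, F, -, hN, hc, hF, -, hB, -⟩ := exists_local_weights hK enc hf.1 hn hωφ' 𝓕 hC
      𝒜.p subset_rfl hne hE hQ hA 𝒜.p
    refine ⟨k, N, c, q, 0, F, hN, hc, hF, fun _ => ⟨hB, hq⟩, fun x hx hxm => ?_⟩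
    exact (hempty.le ⟨hx, hxm⟩ : x ∈ (∅ : Set X)).elim
  · obtain ⟨k, N, c, F, x, hN, hc, hF, hxA, hB, hw⟩ := exists_local_weights hK enc hf.1 hn hωφ' 𝓕
      hC 𝒜.p inter_subset_left hAne hE hQ hA 𝒜.p
    -- Nodes have values in the part and are quantized inside it, so convexity keeps the mixture
    -- there.
    choose Z hZm hZ using fun i => hqz (f (x i)) ⟨mem_image_of_mem _ (hxA i).1, (hxA i).2⟩
    refine ⟨k, N, c, q, Z, F, hN, hc, hF, fun _ => ⟨hB, hq⟩, fun y hy hym => ?_⟩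
    have hsimp := (simplexProj_spec hN (F (enc.encode n k y))).1
    refine ⟨hpart.etaConvex m N hN _ hsimp _ hZm, ?_⟩
    obtain ⟨far, hfar, hnear, hsum⟩ := hw y ⟨hy, hym⟩
    set ρ : ℝ := (εE + εQ + εA) / (24 * 𝒜.Cη) with hρ
    set b : ℝ := ((ω (ωφ n (Metric.diam (D.feat n)).toNNReal) : ℝ≥0) : ℝ) with hb
    have h := 𝒜.dist_eta_le hsimp (y := fun i => f (x i)) (v := f y) he.le (ρ := ρ) (b := b)
      (by positivity) (by positivity) (fun i => (hZ i).le)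
      (fun i j => hf.nndist_le_diam hK hn hωφ' hωφ (hxA i).1 (hxA j).1) far hfar
      (fun i hi => by
        have := (hf.nndist_le_feature hωφ hy (hxA i).1).trans (hnear i hi)
        rw [← NNReal.coe_le_coe] at this
        simpa [hρ] using this) hsum
    have hCs : ((rateConstants enc ω ωφ 𝒜.Cη hC 𝒜.p).Cs n k : ℝ) =
        (1 / (8 * 𝒜.Cη * (b + 1))) ^ 𝒜.p / 2 := by
      simp [rateConstants, hb]
    rw [hCs] at h
    have h1 := diam_mul_tolerance_rpow_le (b := b) (C := 𝒜.Cη) (ε := εA) (p := 𝒜.p)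
      (by positivity) (by positivity) (by positivity) 𝒜.one_le_p
    have h2 := h.trans (add_le_add_left (mul_le_mul_of_nonneg_left (add_le_add_right h1 _)
      (by positivity)) _)
    refine h2.trans ?_
    have h3 : (𝒜.Cη : ℝ) * (2 * ρ + 2 * (εQ / (4 * 𝒜.Cη)) + εA / (8 * 𝒜.Cη)) =
        (εE + εQ + εA) / 12 + εQ / 2 + εA / 8 := by
      rw [hρ]
      field_simp
      ring
    -- The coefficient of `εQ` is the largest: `1/12 + 1/2 + 1/4 + 1/24 = 7/8`. Being below 1, it
    -- leaves room for strict inequalities.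
    have h4 : (εQ : ℝ) / (4 * 𝒜.Cη) ≤ εQ / 4 := by gcongr; linarith
    have h5 : ρ ≤ (εE + εQ + εA) / 24 := by rw [hρ]; gcongr; linarith
    rw [h3]
    have : (0 : ℝ) < εA := hA
    have : (0 : ℝ) < εQ := hQ
    have : (0 : ℝ) < εE := hE
    linarith

end Local

/-! ### Inversion of separation rates -/

section DecInv

variable {S : ℝ → ℝ}

/-- For `0 < t ≤ S 0` the equation `S s = t` has a solution, and strict monotonicity makes the
sublevel set the interval `[s, 1]`. -/
theorem decInv_spec (hc : ContinuousOn S (Icc 0 1)) (ha : StrictAntiOn S (Icc 0 1))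
    (h1 : S 1 = 0) {t : ℝ} (ht : 0 < t) (ht0 : t ≤ S 0) :
    0 ≤ decInv S t ∧ decInv S t < 1 ∧ S (decInv S t) = t := by
  obtain ⟨s, hs, hst⟩ := intermediate_value_Icc' zero_le_one hc ⟨h1 ▸ ht.le, ht0⟩
  have hset : {s | s ∈ Icc (0 : ℝ) 1 ∧ S s ≤ t} = Icc s 1 := by
    ext u
    constructor
    · rintro ⟨hu, hut⟩
      exact ⟨(ha.le_iff_ge hu hs).1 (hst.symm ▸ hut), hu.2⟩
    · intro hu
      have hu' : u ∈ Icc (0 : ℝ) 1 := ⟨hs.1.trans hu.1, hu.2⟩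
      exact ⟨hu', hst ▸ (ha.le_iff_ge hu' hs).2 hu.1⟩
  have hinv : decInv S t = s := by rw [decInv, hset, csInf_Icc hs.2]
  rw [hinv]
  refine ⟨hs.1, lt_of_le_of_ne hs.2 ?_, hst⟩
  rintro rfl
  linarith

theorem tendsto_decInv (hc : ContinuousOn S (Icc 0 1)) (ha : StrictAntiOn S (Icc 0 1))
    (h1 : S 1 = 0) : Tendsto (decInv S) (𝓝[>] 0) (𝓝 1) := by
  have hz : (0 : ℝ) ∈ Icc (0 : ℝ) 1 := ⟨le_rfl, zero_le_one⟩
  have ho : (1 : ℝ) ∈ Icc (0 : ℝ) 1 := ⟨zero_le_one, le_rfl⟩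
  rw [tendsto_order]
  constructor
  · intro a ha1
    have hb : max a 0 ∈ Icc (0 : ℝ) 1 := ⟨le_max_right _ _, max_le ha1.le zero_le_one⟩
    have hb1 : max a 0 < 1 := max_lt ha1 one_pos
    have hSb : 0 < S (max a 0) := h1 ▸ ha hb ho hb1
    filter_upwards [Ioo_mem_nhdsGT hSb] with t ht
    have hSb0 : S (max a 0) ≤ S 0 := ha.antitoneOn hz hb hb.1
    obtain ⟨i0, i1, i2⟩ := decInv_spec hc ha h1 ht.1 (ht.2.le.trans hSb0)
    have : max a 0 < decInv S t := (ha.lt_iff_gt ⟨i0, i1.le⟩ hb).1 (i2.symm ▸ ht.2)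
    exact (le_max_left _ _).trans_lt this
  · intro a ha1
    have hS0 : 0 < S 0 := h1 ▸ ha hz ho one_pos
    filter_upwards [Ioo_mem_nhdsGT hS0] with t ht
    exact (decInv_spec hc ha h1 ht.1 ht.2.le).2.1.trans ha1

end DecInv

/-! ### Separated regions of the target -/

theorem le_dist_of_mem_closure {Z : Type*} [PseudoMetricSpace Z] {A B : Set Z} {c : ℝ}
    (h : ∀ x ∈ A, ∀ y ∈ B, c ≤ dist x y) {x y : Z} (hx : x ∈ closure A) (hy : y ∈ closure B) :
    c ≤ dist x y := by
  have hcl : IsClosed {p : Z × Z | c ≤ dist p.1 p.2} :=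
    isClosed_le continuous_const (continuous_fst.dist continuous_snd)
  have hsub : A ×ˢ B ⊆ {p : Z × Z | c ≤ dist p.1 p.2} := fun p hp => h _ hp.1 _ hp.2
  have := closure_minimal hsub hcl
  rw [closure_prod_eq] at this
  exact this (show (x, y) ∈ closure A ×ˢ closure B from ⟨hx, hy⟩)

/-- The points of a part at distance at least `τ` from all other parts. -/
def innerPart {Y : Type*} [MetricSpace Y] {M : ℕ} (part : Fin M → Set Y) (τ : ℝ) (m : Fin M) : Set Y :=
  {y | y ∈ part m ∧ ∀ m', m' ≠ m → ∀ y' ∈ part m', τ ≤ dist y y'}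

theorem isClosed_innerPart {Y : Type*} [MetricSpace Y] {M : ℕ} {part : Fin M → Set Y}
    (hpart : ∀ m, IsClosed (part m)) (τ : ℝ) (m : Fin M) :
    IsClosed (innerPart part τ m) := by
  have : innerPart part τ m =
      part m ∩ ⋂ m', ⋂ _ : m' ≠ m, ⋂ y' ∈ part m', {y | τ ≤ dist y y'} := by
    ext y
    simp [innerPart]
  rw [this]
  refine (hpart m).inter (isClosed_iInter fun m' => isClosed_iInter fun _ =>
    isClosed_iInter fun y' => isClosed_iInter fun _ => ?_)
  exact isClosed_le continuous_const (continuous_id.dist continuous_const)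

section Regions

variable {X : Type*} [MeasurableSpace X] {μ : Measure X} {Y : Type*} [MetricSpace Y] [MeasurableSpace Y] [BorelSpace Y]
  {𝒜 : QAS Y} {M : ℕ} {part : Fin M → Set Y} {base : Fin M → Y} {S : ℝ → ℝ} {f : X → Y}
  {q : Fin M → ℝ}

/-- The values of a geometrically stable map lie almost surely in a single part. -/
theorem measure_preimage_overlap_eq_zero [IsFiniteMeasure μ]
    (hpart : IsQuantizedGeodesicPartition 𝒜 part base S)
    (hf : IsGeometricallyStable μ 𝒜 part base f q) (m : Fin M) :
    μ (f ⁻¹' (part m \ (⋃ m', ⋃ _ : m' ≠ m, part m')ᶜ)) = 0 := by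
  obtain ⟨hq, C, hC, hstab⟩ := hf
  rw [← measureReal_eq_zero_iff]
  refine le_antisymm ?_ measureReal_nonneg
  have ht : Tendsto (fun δ : ℝ => C * (1 - δ) ^ q m * μ.real (f ⁻¹' part m)) (𝓝[<] 1) (𝓝 0) := by
    have hc : Continuous fun δ : ℝ => C * (1 - δ) ^ q m * μ.real (f ⁻¹' part m) :=
      (continuous_const.mul ((by fun_prop : Continuous fun δ : ℝ => 1 - δ).rpow_const
        fun _ => Or.inr (hq m).le)).mul continuous_const
    have := (hc.tendsto 1).mono_left (nhdsWithin_le_nhds (s := Iio 1))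
    simpa [Real.zero_rpow (hq m).ne'] using this
  refine ge_of_tendsto ht ?_
  filter_upwards [Ioo_mem_nhdsLT (zero_lt_one (α := ℝ))] with δ hδ
  -- Contracted parts avoid the other parts, so for every `δ < 1` the overlap lies in what the
  -- contraction leaves out.
  refine le_trans (measureReal_mono (preimage_mono ?_)) (hstab m δ hδ.1.le hδ.2)
  exact sdiff_subset_sdiff_right (hpart.retract_subset_compl m hδ.1.le hδ.2)

variable [IsProbabilityMeasure μ] [MetricSpace X] [BorelSpace X]

/-- The regions of points far from all other parts exhaust the target. -/
theorem tendsto_measure_innerPart (hfc : Continuous f)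
    (hpart : IsQuantizedGeodesicPartition 𝒜 part base S)
    (hf : IsGeometricallyStable μ 𝒜 part base f q) :
    Tendsto (fun j : ℕ => μ.real (f ⁻¹' ⋃ m, innerPart part (1 / ((j : ℝ) + 1)) m))
      atTop (𝓝 1) := by
  set H : ℕ → Set X := fun j => f ⁻¹' ⋃ m, innerPart part (1 / ((j : ℝ) + 1)) m with hH
  have hmono : Monotone H := by
    intro i j hij
    refine preimage_mono (iUnion_mono fun m y hy => ⟨hy.1, fun m' hm' y' hy' => ?_⟩)
    exact (Nat.one_div_le_one_div hij).trans (hy.2 m' hm' y' hy')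
  -- A value outside the closed union of the other parts has a positive distance to it, hence lies
  -- in some inner region.
  have hcompl : (⋃ j, H j)ᶜ ⊆ ⋃ m, f ⁻¹' (part m \ (⋃ m', ⋃ _ : m' ≠ m, part m')ᶜ) := by
    intro x hx
    obtain ⟨m, hm⟩ := mem_iUnion.1 (hpart.cover.symm ▸ mem_univ (f x) : f x ∈ ⋃ m, part m)
    refine mem_iUnion.2 ⟨m, hm, fun hU => hx ?_⟩
    obtain ⟨r, hr, hball⟩ := Metric.isOpen_iff.1 (hpart.isOpen_compl_iUnion m) _ hU
    obtain ⟨j, hj⟩ := exists_nat_one_div_lt hr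
    refine mem_iUnion.2 ⟨j, mem_iUnion.2 ⟨m, hm, fun m' hm' y' hy' => ?_⟩⟩
    by_contra! hlt
    have : y' ∈ Metric.ball (f x) r := by
      rw [Metric.mem_ball, dist_comm]
      exact hlt.trans hj
    exact hball this (mem_iUnion₂.2 ⟨m', hm', hy'⟩)
  have hnull : μ (⋃ j, H j)ᶜ = 0 := measure_mono_null hcompl
    (measure_iUnion_null fun m => measure_preimage_overlap_eq_zero hpart hf m)
  have hmeas : MeasurableSet (⋃ j, H j) := MeasurableSet.iUnion fun j =>
    ((isClosed_iUnion_of_finite fun m =>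
      isClosed_innerPart hpart.isClosed _ m).preimage hfc).measurableSet
  have hone : μ (⋃ j, H j) = 1 := (prob_compl_eq_zero_iff hmeas).1 hnull
  have ht := tendsto_measure_iUnion_atTop (μ := μ) hmono
  rw [hone] at ht
  exact (ENNReal.tendsto_toReal ENNReal.one_ne_top).comp ht

/-- Closed separated regions in the parts, which carry most of the push-forward measure. -/
theorem exists_separated_regions (hfc : Continuous f)
    (hpart : IsQuantizedGeodesicPartition 𝒜 part base S) (hq : ∀ m, 0 < q m) {C : ℝ} (hC : 0 < C)
    (hstab : ∀ m, ∀ δ : ℝ, 0 ≤ δ → δ < 1 →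
      μ.real (f ⁻¹' (part m \ 𝒜.retract (part m) (base m) δ))
        ≤ C * (1 - δ) ^ q m * μ.real (f ⁻¹' part m))
    {εA εs : ℝ≥0} (hs : 0 < εs) (hsA : εs ≤ εA) (hs2 : εs ≤ 1 / 2) (hsS : 3 * (εs : ℝ) ≤ S 0) :
    ∃ (σ : ℝ≥0) (E : Fin M → Set Y), 0 < σ ∧ σ ≤ εA ∧ σ ≤ 1 / 2 ∧
      (HasUniformGap 𝒜 part base S → σ = εs) ∧ (∀ m, IsClosed (E m)) ∧ (∀ m, E m ⊆ part m) ∧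
      (∀ m m', m ≠ m' → ∀ y ∈ E m, ∀ y' ∈ E m', 3 * (σ : ℝ) ≤ dist y y') ∧
      1 - C * ∑ m, (1 - decInv S (3 * εs)) ^ q m * μ.real (f ⁻¹' part m) ≤
        μ.real (f ⁻¹' ⋃ m, E m) := by
  have hs3 : 0 < 3 * (εs : ℝ) := mul_pos three_pos hs
  obtain ⟨d0, d1, dS⟩ := decInv_spec hpart.S_continuous hpart.S_anti hpart.S_one hs3 hsS
  set δs := decInv S (3 * εs) with hδs
  by_cases hgap : HasUniformGap 𝒜 part base S
  · refine ⟨εs, fun m => closure (𝒜.retract (part m) (base m) δs), hs, hsA, hs2, fun _ => rfl,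
      fun m => isClosed_closure,
      fun m => closure_minimal (hpart.retract_subset m ⟨d0, d1.le⟩) (hpart.isClosed m),
      fun m m' hm y hy y' hy' => ?_, ?_⟩
    · rw [← dS]
      exact le_dist_of_mem_closure (hgap m m' hm δs ⟨d0, d1.le⟩) hy hy'
    · set H := f ⁻¹' ⋃ m, closure (𝒜.retract (part m) (base m) δs) with hH
      have hmeas : MeasurableSet H :=
        ((isClosed_iUnion_of_finite fun m => isClosed_closure).preimage hfc).measurableSet
      have hcompl : Hᶜ ⊆ ⋃ m, f ⁻¹' (part m \ 𝒜.retract (part m) (base m) δs) := by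
        intro x hx
        obtain ⟨m, hm⟩ := mem_iUnion.1 (hpart.cover.symm ▸ mem_univ (f x) : f x ∈ ⋃ m, part m)
        exact mem_iUnion.2 ⟨m, hm, fun h => hx (mem_iUnion.2 ⟨m, subset_closure h⟩)⟩
      have h1 : μ.real Hᶜ ≤ C * ∑ m, (1 - δs) ^ q m * μ.real (f ⁻¹' part m) := by
        refine (measureReal_mono hcompl).trans ((measureReal_iUnion_fintype_le _).trans ?_)
        rw [Finset.mul_sum]
        refine Finset.sum_le_sum fun m _ => ?_
        rw [← mul_assoc]
        exact hstab m δs d0 d1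
      rw [probReal_compl_eq_one_sub hmeas] at h1
      linarith
  -- Without a pointwise gap, the loss allowed by the mass bound is still strictly positive: `δs <
  -- 1` and some part has positive mass. Inner regions with small enough distance lose less than
  -- that.
  · have hslack : 0 < C * ∑ m, (1 - δs) ^ q m * μ.real (f ⁻¹' part m) := by
      have hd : 0 < 1 - δs := by linarith
      refine mul_pos hC (Finset.sum_pos' (fun m _ => by positivity) ?_)
      by_contra! hcon
      have hzero : ∀ m, μ (f ⁻¹' part m) = 0 := fun m => by
        have h1 := hcon m (Finset.mem_univ m)
        have h2 : 0 < (1 - δs) ^ q m := Real.rpow_pos_of_pos hd _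
        have h3 : μ.real (f ⁻¹' part m) = 0 :=
          le_antisymm (nonpos_of_mul_nonpos_right h1 h2) measureReal_nonneg
        exact (measureReal_eq_zero_iff (by finiteness)).1 h3
      have huniv : μ univ = 0 := by
        have : (univ : Set X) = ⋃ m, f ⁻¹' part m := by
          rw [← preimage_iUnion, hpart.cover, preimage_univ]
        rw [this]
        exact measure_iUnion_null hzero
      simp at huniv
    obtain ⟨j, hj⟩ := ((tendsto_measure_innerPart hfc hpart ⟨hq, C, hC, hstab⟩).eventually_const_lt
      (sub_lt_self 1 hslack)).exists
    have hA : 0 < εA := hs.trans_le hsA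
    -- A third of the separation of the inner regions, capped as required.
    refine ⟨min (1 / (3 * ((j : ℝ≥0) + 1))) (min εA (1 / 2)), innerPart part (1 / ((j : ℝ) + 1)),
      by positivity, (min_le_right _ _).trans (min_le_left _ _),
      (min_le_right _ _).trans (min_le_right _ _), fun h => absurd h hgap,
      fun m => isClosed_innerPart hpart.isClosed _ m, fun m y hy => hy.1,
      fun m m' hm y hy y' hy' => ?_, hj.le⟩
    refine le_trans ?_ (hy.2 m' hm.symm y' hy'.1)
    have h1 : ((min (1 / (3 * ((j : ℝ≥0) + 1))) (min εA (1 / 2)) : ℝ≥0) : ℝ) ≤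
        1 / (3 * ((j : ℝ) + 1)) := by
      exact_mod_cast min_le_left (1 / (3 * ((j : ℝ≥0) + 1))) (min εA (1 / 2))
    have h2 : 3 * (1 / (3 * ((j : ℝ) + 1))) = 1 / ((j : ℝ) + 1) := by field_simp
    linarith

end Regions

/-! ### The regions of the source -/

section Source

variable {X : Type*} [MetricSpace X]

theorem complDist_pos {A : Set X} {x : X} (hx : x ∈ interior A) : 0 < complDist A x := by
  unfold complDist
  split_ifs with h
  · exact one_pos
  · have hne : Aᶜ.Nonempty := nonempty_compl.2 h
    rw [← Metric.infDist_closure]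
    refine (isClosed_closure.notMem_iff_infDist_pos hne.closure).1 ?_
    rw [closure_compl]
    exact fun h => h hx

theorem complDist_eq_zero {A : Set X} {x : X} (hx : x ∉ A) : complDist A x = 0 := by
  unfold complDist
  rw [if_neg fun h : A = univ => hx (h ▸ mem_univ x)]
  exact Metric.infDist_zero_of_mem hx

namespace FeatureDecomposition

variable [MeasurableSpace X] {μ : Measure X}

/-- The overlap of a part with the other parts. -/
def overlap (D : FeatureDecomposition X μ) (n : ℕ) : Set X :=
  D.part n ∩ ⋃ m : ℕ, ⋃ _ : m ≠ n ∧ (m : ℕ∞) < D.N, D.part m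

/-- The interior points of a part which lie in no other part. -/
def pureRegion (D : FeatureDecomposition X μ) (n : ℕ) : Set X :=
  interior (D.part n) \ D.overlap n

variable (D : FeatureDecomposition X μ)

theorem notMem_part_of_mem_pureRegion {n i : ℕ} {x : X} (hx : x ∈ D.pureRegion n) (hin : i ≠ n)
    (hi : (i : ℕ∞) < D.N) : x ∉ D.part i := fun h =>
  hx.2 ⟨interior_subset hx.1, mem_iUnion₂.2 ⟨i, ⟨hin, hi⟩, h⟩⟩

/-- At a pure point the other complement distances vanish, while its own is positive because the
point is interior. -/
theorem weightX_eq_ite {L n i : ℕ} {x : X} (hx : x ∈ D.pureRegion n) (hn : n < L)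
    (hL : (L : ℕ∞) ≤ D.N) (hi : i < L) : weightX D L i x = if i = n then 1 else 0 := by
  have hzero : ∀ i < L, i ≠ n → complDist (D.part i) x = 0 := fun i hi hin =>
    complDist_eq_zero (D.notMem_part_of_mem_pureRegion hx hin
      ((Nat.cast_lt.2 hi).trans_le hL))
  have hsum : ∑ i ∈ Finset.range L, complDist (D.part i) x = complDist (D.part n) x :=
    Finset.sum_eq_single_of_mem n (Finset.mem_range.2 hn)
      fun i hi hin => hzero i (Finset.mem_range.1 hi) hin
  rw [weightX, hsum]
  split_ifs with h
  · rw [h, div_self (complDist_pos hx.1).ne']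
  · rw [hzero i hi h, zero_div]

theorem measurableSet_pureRegion [BorelSpace X] {n : ℕ} (hn : (n : ℕ∞) < D.N) :
    MeasurableSet (D.pureRegion n) :=
  isOpen_interior.measurableSet.diff ((D.isClosed n hn).measurableSet.inter
    (MeasurableSet.iUnion fun m => MeasurableSet.iUnion fun hm => (D.isClosed m hm.2).measurableSet))

theorem measure_iUnion_overlap_eq_zero : μ (⋃ n : ℕ, ⋃ _ : (n : ℕ∞) < D.N, D.overlap n) = 0 :=
  measure_iUnion_null fun n => measure_iUnion_null fun hn => D.overlap_null n hn

theorem N_pos [NeZero μ] : 0 < D.N := by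
  by_contra! h
  have h0 : D.N = 0 := le_antisymm h zero_le
  have hc := D.cover (by rw [h0]; exact ENat.zero_ne_top)
  have : (univ : Set X) = ∅ := by
    rw [← hc]
    simp [h0]
  exact NeZero.ne μ (Measure.measure_univ_eq_zero.1 (by rw [this, measure_empty]))

/-- For a finite decomposition, almost every point is pure. -/
theorem measure_compl_pureRegion_of_ne_top {L : ℕ} (hL : D.N = L) :
    μ (⋃ n : ℕ, ⋃ _ : n < L, D.pureRegion n)ᶜ = 0 := by
  refine measure_mono_null (fun x hx => ?_) D.measure_iUnion_overlap_eq_zero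
  have hlt : ∀ {n : ℕ}, (n : ℕ∞) < D.N ↔ n < L := by
    intro n
    rw [hL, Nat.cast_lt]
  have hcov : x ∈ ⋃ n : ℕ, ⋃ _ : (n : ℕ∞) < D.N, D.part n := by
    rw [D.cover (by rw [hL]; exact ENat.natCast_ne_top L)]
    exact mem_univ x
  obtain ⟨n, hn, hxn⟩ := mem_iUnion₂.1 hcov
  by_contra hov
  have hnot : ∀ m, m ≠ n ∧ (m : ℕ∞) < D.N → x ∉ D.part m := fun m hm hxm =>
    hov (mem_iUnion₂.2 ⟨n, hn, hxn, mem_iUnion₂.2 ⟨m, hm, hxm⟩⟩)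
  have hfin : {m : ℕ | m ≠ n ∧ (m : ℕ∞) < D.N}.Finite :=
    (Set.finite_Iio L).subset fun m hm => hlt.1 hm.2
  have hclosed : IsClosed (⋃ m ∈ {m : ℕ | m ≠ n ∧ (m : ℕ∞) < D.N}, D.part m) :=
    hfin.isClosed_biUnion fun m hm => D.isClosed m hm.2
  -- The other parts form a finite closed union avoiding `x`, and its complement is an open
  -- neighbourhood inside `part n`.
  have hint : x ∈ interior (D.part n) := by
    refine mem_interior.2 ⟨_, fun y hy => ?_, hclosed.isOpen_compl, fun h => ?_⟩
    · have hycov : y ∈ ⋃ n : ℕ, ⋃ _ : (n : ℕ∞) < D.N, D.part n := by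
        rw [D.cover (by rw [hL]; exact ENat.natCast_ne_top L)]
        exact mem_univ y
      obtain ⟨m, hm, hym⟩ := mem_iUnion₂.1 hycov
      by_cases hmn : m = n
      · exact hmn ▸ hym
      · exact absurd (mem_iUnion₂.2 ⟨m, ⟨hmn, hm⟩, hym⟩) hy
    · obtain ⟨m, hm, hxm⟩ := mem_iUnion₂.1 h
      exact hnot m hm hxm
  exact hx (mem_iUnion₂.2 ⟨n, hlt.1 hn, hint, fun h => hov (mem_iUnion₂.2 ⟨n, hn, h⟩)⟩)

/-- For an infinite decomposition, almost every point which is not in the tail is pure. -/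
theorem measure_compl_pureRegion_of_eq_top [IsFiniteMeasure μ] (hN : D.N = ⊤) (L : ℕ) :
    μ.real (⋃ n : ℕ, ⋃ _ : n < L, D.pureRegion n)ᶜ ≤
      μ.real (⋃ m : ℕ, ⋃ _ : L ≤ m, D.part m) := by
  have hlt : ∀ n : ℕ, (n : ℕ∞) < D.N := fun n => hN ▸ ENat.natCast_lt_top n
  -- An infinite union of closed parts need not be closed, so points are made interior by discarding
  -- the null frontiers.
  set Z := (⋃ n : ℕ, D.part n)ᶜ ∪ (⋃ n : ℕ, frontier (D.part n)) ∪
    ⋃ n : ℕ, ⋃ _ : (n : ℕ∞) < D.N, D.overlap n with hZ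
  have hnull : μ Z = 0 := by
    rw [hZ, measure_union_null_iff, measure_union_null_iff]
    exact ⟨⟨D.cover_ae hN, measure_iUnion_null (D.frontier_null hN)⟩,
      D.measure_iUnion_overlap_eq_zero⟩
  have hsub : (⋃ n : ℕ, ⋃ _ : n < L, D.pureRegion n)ᶜ ⊆
      Z ∪ ⋃ m : ℕ, ⋃ _ : L ≤ m, D.part m := by
    intro x hx
    by_contra hcon
    rw [hZ] at hcon
    simp only [mem_union, not_or, notMem_compl_iff] at hcon
    obtain ⟨⟨⟨hcov, hfr⟩, hov⟩, htail⟩ := hcon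
    obtain ⟨n, hn⟩ := mem_iUnion.1 hcov
    have hnL : n < L := by
      by_contra! h
      exact htail (mem_iUnion₂.2 ⟨n, h, hn⟩)
    refine hx (mem_iUnion₂.2 ⟨n, hnL, ?_, fun h => hov (mem_iUnion₂.2 ⟨n, hlt n, h⟩)⟩)
    by_contra hint
    exact hfr (mem_iUnion.2 ⟨n, subset_closure hn, hint⟩)
  have h0 : μ.real Z = 0 := (measureReal_eq_zero_iff (by finiteness)).2 hnull
  calc _ ≤ μ.real (Z ∪ ⋃ m : ℕ, ⋃ _ : L ≤ m, D.part m) := measureReal_mono hsub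
    _ ≤ μ.real Z + μ.real (⋃ m : ℕ, ⋃ _ : L ≤ m, D.part m) := measureReal_union_le _ _
    _ = _ := by rw [h0, zero_add]

/-- The tail term of the mass bound. -/
def tailTerm (C₁ : ℝ) (L : ℕ) : ℝ :=
  open scoped Classical in if (L : ℕ∞) < D.N then C₁ * (L : ℝ) ^ (-D.r) else 0

/-- The pure points of the first parts carry almost all of the mass, up to the tail term, which can
be made arbitrarily small. -/
theorem exists_tail_bound [IsProbabilityMeasure μ] :
    ∃ C₁ : ℝ, 0 < C₁ ∧ ∀ δ : ℝ, 0 < δ → ∃ L : ℕ, 1 ≤ L ∧ (L : ℕ∞) ≤ D.N ∧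
      μ.real (⋃ n : ℕ, ⋃ _ : n < L, D.pureRegion n)ᶜ ≤ D.tailTerm C₁ L ∧ D.tailTerm C₁ L < δ := by
  by_cases hN : D.N = ⊤
  · obtain ⟨C₁, hC₁, htail⟩ := D.tail hN
    refine ⟨C₁, hC₁, fun δ hδ => ?_⟩
    have ht : Tendsto (fun L : ℕ => C₁ * (L : ℝ) ^ (-D.r)) atTop (𝓝 0) := by
      simpa using ((tendsto_rpow_neg_atTop D.r_pos).comp
        tendsto_natCast_atTop_atTop).const_mul C₁
    obtain ⟨L, hL1, hL⟩ := ((eventually_ge_atTop 1).and (ht.eventually_lt_const hδ)).exists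
    have hlt : (L : ℕ∞) < D.N := hN ▸ ENat.natCast_lt_top L
    have heq : D.tailTerm C₁ L = C₁ * (L : ℝ) ^ (-D.r) := if_pos hlt
    refine ⟨L, hL1, hlt.le, ?_, heq ▸ hL⟩
    rw [heq]
    exact (D.measure_compl_pureRegion_of_eq_top hN L).trans (htail L hL1)
  · refine ⟨1, one_pos, fun δ hδ => ?_⟩
    obtain ⟨L, hL⟩ := ENat.ne_top_iff_exists.1 hN
    have heq : D.tailTerm 1 L = 0 := if_neg (hL ▸ lt_irrefl _)
    refine ⟨L, ?_, hL.le, ?_, heq ▸ hδ⟩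
    · have := D.N_pos
      rw [← hL] at this
      exact_mod_cast this
    · rw [heq, Measure.real, D.measure_compl_pureRegion_of_ne_top hL.symm, ENNReal.toReal_zero]

end FeatureDecomposition

/-- As `ε → 0` one has `δ⋆ → 1`, and the positive exponents remove both sums. Hence the scale can be
chosen after `L`, with only the tail left. -/
theorem tendsto_massBound [MeasurableSpace X] {μ : Measure X} (D : FeatureDecomposition X μ)
    {Y : Type*} [MetricSpace Y] {M : ℕ} (part : Fin M → Set Y) {S : ℝ → ℝ} (f : X → Y)
    {q : Fin M → ℝ} (hq : ∀ m, 0 < q m) (hc : ContinuousOn S (Icc 0 1))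
    (ha : StrictAntiOn S (Icc 0 1)) (h1 : S 1 = 0) (C₀ C₁ C₂ : ℝ) {L : ℕ} (hL : (L : ℕ∞) ≤ D.N) :
    Tendsto (fun ε => massBound D part S f q C₀ C₁ C₂ ε L) (𝓝[>] 0) (𝓝 (1 - D.tailTerm C₁ L)) := by
  have h3 : Tendsto (fun ε : ℝ => 3 * ε) (𝓝[>] 0) (𝓝[>] 0) := by
    refine tendsto_nhdsWithin_of_tendsto_nhds_of_eventually_within _ ?_ ?_
    · have : Tendsto (fun ε : ℝ => 3 * ε) (𝓝 0) (𝓝 (3 * 0)) := tendsto_id.const_mul 3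
      rw [mul_zero] at this
      exact this.mono_left nhdsWithin_le_nhds
    · filter_upwards [self_mem_nhdsWithin] with ε hε
      exact mul_pos (three_pos (α := ℝ)) hε
  have hd : Tendsto (fun ε : ℝ => 1 - decInv S (3 * ε)) (𝓝[>] 0) (𝓝 0) := by
    simpa using ((tendsto_decInv hc ha h1).comp h3).const_sub 1
  have hsum1 : Tendsto (fun ε : ℝ => ∑ m, (1 - decInv S (3 * ε)) ^ q m * μ.real (f ⁻¹' part m))
      (𝓝[>] 0) (𝓝 0) := by
    rw [show 𝓝 (0 : ℝ) = 𝓝 (∑ _m : Fin M, 0) by rw [Finset.sum_const_zero]]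
    apply tendsto_finsetSum
    intro m _
    have := (hd.rpow_const (Or.inr (hq m).le)).mul_const (μ.real (f ⁻¹' part m))
    rwa [Real.zero_rpow (hq m).ne', zero_mul] at this
  have hsum2 : Tendsto (fun ε : ℝ => ∑ n ∈ Finset.range L, C₂ * μ.real (D.part n) * ε ^ D.ρ n)
      (𝓝[>] 0) (𝓝 0) := by
    rw [show 𝓝 (0 : ℝ) = 𝓝 (∑ _n ∈ Finset.range L, 0) by rw [Finset.sum_const_zero]]
    refine tendsto_finsetSum _ fun n hn => ?_
    have hρ := D.ρ_pos n ((Nat.cast_lt.2 (Finset.mem_range.1 hn)).trans_le hL)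
    have ht : Tendsto (fun ε : ℝ => ε) (𝓝[>] 0) (𝓝 0) := tendsto_id.mono_left nhdsWithin_le_nhds
    have := (ht.rpow_const (Or.inr hρ.le)).const_mul (C₂ * μ.real (D.part n))
    rwa [Real.zero_rpow hρ.ne', mul_zero] at this
  have := (((hsum1.const_mul C₀).const_sub 1).sub_const (D.tailTerm C₁ L)).sub hsum2
  rwa [mul_zero, sub_zero, sub_zero] at this

end Source

/-! ### Point masses -/

section Dirac

variable {Z : Type*} [MetricSpace Z] [MeasurableSpace Z] [BorelSpace Z]

theorem W1_diracP1_le (a b : Z) : W1 (diracP1 a) (diracP1 b) ≤ edist a b := by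
  have h1 : (Measure.dirac (a, b)).map Prod.fst = Measure.dirac a :=
    Measure.map_dirac' measurable_fst (a, b)
  have h2 : (Measure.dirac (a, b)).map Prod.snd = Measure.dirac b :=
    Measure.map_dirac' measurable_snd (a, b)
  have h3 : ∫⁻ z : Z × Z, edist z.1 z.2 ∂Measure.dirac (a, b) = edist a b :=
    lintegral_dirac (a, b) fun z : Z × Z => edist z.1 z.2
  rw [← h3]
  exact iInf₂_le (f := fun (π : Measure (Z × Z))
    (_ : π.map Prod.fst = (diracP1 a).1 ∧ π.map Prod.snd = (diracP1 b).1) =>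
      ∫⁻ z : Z × Z, edist z.1 z.2 ∂π) (Measure.dirac (a, b)) ⟨h1, h2⟩

end Dirac

end

/-! ### Assembly: scale, good set, parameters, and the model as a point mass. -/

theorem theorem3p5
    {X : Type*} [MetricSpace X] [MeasurableSpace X] [BorelSpace X]
    (μ : Measure X) [IsProbabilityMeasure μ]
    (hK : IsCompact μ.support) (hμK : μ μ.supportᶜ = 0)
    (D : FeatureDecomposition X μ) (ωφ : ℕ → ℝ≥0 → ℝ≥0)
    (hωφ : ∀ n : ℕ, (n : ℕ∞) < D.N → IsHolderLikeModulus (ωφ n) ∧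
      ∀ x ∈ D.core n, ∀ y ∈ D.core n, nndist x y ≤ ωφ n (nndist (D.φ n x) (D.φ n y)))
    (hD : (∀ n : ℕ, (n : ℕ∞) < D.N →
        IsQuasisymmetricOn (D.φ n) (D.part n) ∧ IsDoubling (D.core n)) ∨
      (∀ n : ℕ, (n : ℕ∞) < D.N → IsDoubling (D.feat n)))
    (enc : BAPEncoding D)
    {Y : Type*} [MetricSpace Y] [SecondCountableTopology Y] [MeasurableSpace Y] [BorelSpace Y]
    (𝒜 : QAS Y) (ω : ℝ≥0 → ℝ≥0) :
    ∃ B : RateConstants,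
    ∀ (M : ℕ) (part : Fin M → Set Y) (base : Fin M → Y) (S : ℝ → ℝ),
      IsQuantizedGeodesicPartition 𝒜 part base S →
    ∀ (𝓕 : UniversalApproximator) (f : X → Y) (q : Fin M → ℝ),
      IsHolderLike ω f → IsGeometricallyStable μ 𝒜 part base f q →
    ∃ C₀ C₁ C₂ : ℝ, 0 < C₀ ∧ 0 < C₁ ∧ 0 < C₂ ∧
    ∀ (εA : ℝ≥0) (δ : ℝ), 0 < εA → 0 < δ → δ ≤ 1 →
    ∃ (εs : ℝ≥0) (L : ℕ) (σ : ℝ≥0) (G : Set X),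
      0 < εs ∧ εs ≤ εA ∧ (εs : ℝ≥0∞) ≤ D.infDiam ∧ εs ≤ 1 / 2 ∧
      1 ≤ L ∧ (L : ℕ∞) ≤ D.N ∧
      0 < σ ∧ σ ≤ εA ∧ σ ≤ 1 / 2 ∧ (HasUniformGap 𝒜 part base S → σ = εs) ∧
      MeasurableSet G ∧
      massBound D part S f q C₀ C₁ C₂ εs L ≤ μ.real G ∧
      1 - δ ≤ massBound D part S f q C₀ C₁ C₂ εs L ∧
    ∀ εQ εE : ℝ≥0, 0 < εQ → 0 < εE →
    ∃ (P : ModelParams enc 𝒜 M) (That : X → P1 Y),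
      (∀ n < L, ∀ m,
        1 ≤ P.N n m ∧ 1 ≤ P.c n m ∧ 1 ≤ P.N' n m ∧ 1 ≤ P.c' n m ∧
        P.fhat n m ∈ 𝓕.fam (enc.dim n (P.k n m)) (P.N n m) (P.c n m) ∧
        P.g n m ∈ 𝓕.fam (enc.dim n (P.k' n m)) (P.N' n m) (P.c' n m)) ∧
      (∀ n < L, ∀ m, (D.core n).Nonempty →
        ParamBounds enc ω ωφ 𝓕 B n (P.k n m) (P.N n m) (P.c n m) εE εQ εA 𝒜.p ∧
        ParamBounds enc ω ωφ 𝓕 B n (P.k' n m) (P.N' n m) (P.c' n m) σ σ σ 1 ∧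
        𝒜.D (P.q n m) = 𝒜.quantModulus (part m) (f '' D.core n ∩ part m)
          (εQ / (4 * 𝒜.Cη))) ∧
      (⨆ x ∈ G, W1 (That x) (diracP1 (f x))) < ((εA + εQ + εE : ℝ≥0) : ℝ≥0∞) ∧
      (∀ x ∈ G, (That x).1 = ∑ n ∈ Finset.range L, ∑ m,
        ENNReal.ofReal (weightX D L n x * P.weightY L εA m x) •
          Measure.dirac (P.localMap n m x)) ∧
      (∀ x ∈ G, ∃ m, P.weightY L εA m x = 1 ∧
        ∃ ν : P1 (part m), ν.1.map Subtype.val = (That x).1 ∧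
          ∀ β : P1 (part m) → part m, IsContractingBarycenter β →
            dist (β ν : Y) (f x) < εA + εQ + εE) := by
  classical
  have hC : 0 < 𝒜.Cη := zero_lt_one.trans_le 𝒜.one_le_Cη
  -- The constants precede `f`, while the modulus property of `ω` comes with `f`; if it fails, no
  -- such `f` exists.
  by_cases hω : IsHolderLikeModulus ω
  swap
  · exact ⟨rateConstants enc ω ωφ 𝒜.Cη hC 𝒜.p, fun M part base S _ 𝓕 f q hf => absurd hf.1 hω⟩
  refine ⟨rateConstants enc ω ωφ 𝒜.Cη hC 𝒜.p, fun M part base S hpart 𝓕 f q hf hstab => ?_⟩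
  have hfc := hf.continuous
  obtain ⟨hq, C₀, hC₀, hstab⟩ := hstab
  obtain ⟨C₁, hC₁, htail⟩ := D.exists_tail_bound
  refine ⟨C₀, C₁, 1, hC₀, hC₁, one_pos, fun εA δ hA hδ hδ1 => ?_⟩
  obtain ⟨L, hL1, hLN, hLtail, hLδ⟩ := htail δ hδ
  -- the choice of the scale
  have hS0 : 0 < S 0 := hpart.S_one ▸ hpart.S_anti ⟨le_rfl, zero_le_one⟩ ⟨zero_le_one, le_rfl⟩ one_pos
  -- `D.infDiam` may be infinite, so a positive real number below it serves as the cap.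
  obtain ⟨d, hd0, hd⟩ := ENNReal.lt_iff_exists_nnreal_btwn.1 D.diam_pos
  have hd0' : (0 : ℝ) < d := by exact_mod_cast hd0
  have hA' : (0 : ℝ) < εA := hA
  have hbound := (tendsto_massBound D part f hq hpart.S_continuous hpart.S_anti hpart.S_one C₀ C₁ 1
    hLN).eventually_const_lt (sub_lt_sub_left hLδ 1)
  have hsmall : ∀ᶠ ε in 𝓝[>] (0 : ℝ), ε ∈ Ioo (0 : ℝ) (min (min (εA : ℝ) d) (min (1 / 2) (S 0 / 3))) :=
    Ioo_mem_nhdsGT (by positivity)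
  obtain ⟨ε, hεbound, hε0, hεlt⟩ := (hbound.and hsmall).exists
  lift ε to ℝ≥0 using hε0.le with εs
  rw [lt_min_iff, lt_min_iff, lt_min_iff] at hεlt
  obtain ⟨⟨hεA, hεd⟩, hε2, hεS⟩ := hεlt
  have hs0 : 0 < εs := hε0
  have hsA : εs ≤ εA := NNReal.coe_le_coe.1 hεA.le
  have hs2 : εs ≤ 1 / 2 := by
    rw [← NNReal.coe_le_coe]
    simpa using hε2.le
  have hsd : (εs : ℝ≥0∞) ≤ D.infDiam :=
    (ENNReal.coe_le_coe.2 (NNReal.coe_le_coe.1 hεd.le)).trans hd.le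
  obtain ⟨σ, E, hσ, hσA, hσ2, hσgap, hEc, hEpart, hEsep, hEmass⟩ :=
    exists_separated_regions hfc hpart hq hC₀ hstab hs0 hsA hs2 (by linarith)
  -- the good set
  set W : Set X := ⋃ n : ℕ, ⋃ _ : n < L, D.pureRegion n with hW
  set H : Set X := f ⁻¹' ⋃ m, E m with hH
  have hlt : ∀ n < L, (n : ℕ∞) < D.N := fun n hn => (Nat.cast_lt.2 hn).trans_le hLN
  have hWm : MeasurableSet W := MeasurableSet.iUnion fun n => MeasurableSet.iUnion fun hn =>
    D.measurableSet_pureRegion (hlt n hn)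
  have hHm : MeasurableSet H := ((isClosed_iUnion_of_finite hEc).preimage hfc).measurableSet
  set G : Set X := μ.support ∩ (H ∩ W) with hG
  have hGm : MeasurableSet G := hK.isClosed.measurableSet.inter (hHm.inter hWm)
  have hGmass : massBound D part S f q C₀ C₁ 1 εs L ≤ μ.real G := by
    have h1 : H ⊆ G ∪ (μ.supportᶜ ∪ Wᶜ) := by
      intro x hx
      by_cases hxK : x ∈ μ.support
      · by_cases hxW : x ∈ W
        · exact Or.inl ⟨hxK, hx, hxW⟩
        · exact Or.inr (Or.inr hxW)
      · exact Or.inr (Or.inl hxK)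
    have h2 : μ.real H ≤ μ.real G + (μ.real μ.supportᶜ + μ.real Wᶜ) :=
      (measureReal_mono h1).trans ((measureReal_union_le _ _).trans
        (add_le_add_right (measureReal_union_le _ _) _))
    have h3 : μ.real μ.supportᶜ = 0 := (measureReal_eq_zero_iff (by finiteness)).2 hμK
    -- Pure regions reach up to the null boundaries, so the last sum only lowers the bound and `C₂ =
    -- 1` suffices.
    have h4 : 0 ≤ ∑ n ∈ Finset.range L, 1 * μ.real (D.part n) * (εs : ℝ) ^ D.ρ n :=
      Finset.sum_nonneg fun n _ => by positivity
    change 1 - C₀ * ∑ m, (1 - decInv S (3 * εs)) ^ q m * μ.real (f ⁻¹' part m)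
      - D.tailTerm C₁ L - ∑ n ∈ Finset.range L, 1 * μ.real (D.part n) * (εs : ℝ) ^ D.ρ n ≤ _
    linarith
  refine ⟨εs, L, σ, G, hs0, hsA, hsd, hs2, hL1, hLN, hσ, hσA, hσ2, hσgap, hGm, hGmass,
    hεbound.le, fun εQ εE hQ hE => ?_⟩
  -- the parameters
  have hmap : ∀ (n : ℕ) (m : Fin M), ∃ (k N c q : ℕ) (Z : Fin N → Fin (𝒜.D q) → ℝ)
      (F : Euc (enc.dim n k) → Euc N), n < L →
      1 ≤ N ∧ 1 ≤ c ∧ F ∈ 𝓕.fam (enc.dim n k) N c ∧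
      ((D.core n).Nonempty →
        ParamBounds enc ω ωφ 𝓕 (rateConstants enc ω ωφ 𝒜.Cη hC 𝒜.p) n k N c εE εQ εA 𝒜.p ∧
        𝒜.D q = 𝒜.quantModulus (part m) (f '' D.core n ∩ part m) (εQ / (4 * 𝒜.Cη))) ∧
      ∀ x ∈ D.core n, f x ∈ part m →
        𝒜.etaHat N q (simplexProj (F (enc.encode n k x))) Z ∈ part m ∧
        dist (𝒜.etaHat N q (simplexProj (F (enc.encode n k x))) Z) (f x) ≤
          (εA + εQ + εE) * (7 / 8) := by
    intro n m
    by_cases hn : n < L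
    · obtain ⟨k, N, c, q, Z, F, h⟩ := exists_local_map hK enc hf (hlt n hn) (hωφ n (hlt n hn)).1
        (hωφ n (hlt n hn)).2 hpart 𝓕 hC hA hQ hE m
      exact ⟨k, N, c, q, Z, F, fun _ => h⟩
    -- Parts of index at least `L` do not enter the model and get arbitrary values.
    · exact ⟨0, 0, 0, 0, 0, 0, fun h => absurd h hn⟩
  have hclass : ∀ (n : ℕ) (m : Fin M), ∃ (k N c : ℕ) (z : Fin N → ℝ)
      (F : Euc (enc.dim n k) → Euc N), n < L →
      1 ≤ N ∧ 1 ≤ c ∧ F ∈ 𝓕.fam (enc.dim n k) N c ∧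
      ((D.core n).Nonempty →
        ParamBounds enc ω ωφ 𝓕 (rateConstants enc ω ωφ 𝒜.Cη hC 𝒜.p) n k N c σ σ σ 1) ∧
      ∀ x ∈ D.core n, ∀ m', f x ∈ E m' →
        (∑ i, simplexProj (F (enc.encode n k x)) i * |z i| ≤ εA / 4 ↔ m' = m) := by
    intro n m
    by_cases hn : n < L
    · obtain ⟨k, N, c, z, F, h⟩ := exists_local_classifier hK enc hf (hlt n hn)
        (hωφ n (hlt n hn)).1 (hωφ n (hlt n hn)).2 𝒜 𝓕 hC hA hσ hσ2 E hEsep m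
      exact ⟨k, N, c, z, F, fun _ => h⟩
    · exact ⟨0, 0, 0, 0, 0, fun h => absurd h hn⟩
  choose k N c qq Z F hmap using hmap
  choose k' N' c' z g hclass using hclass
  let P : ModelParams enc 𝒜 M := ⟨k, N, c, qq, Z, F, k', N', c', z, g⟩
  -- the model on the good set
  have hGpt : ∀ x ∈ G, ∃ n m, n < L ∧ (∀ i < L, weightX D L i x = if i = n then 1 else 0) ∧
      (∀ m', P.weightY L εA m' x = if m' = m then 1 else 0) ∧ P.localMap n m x ∈ part m ∧
      dist (P.localMap n m x) (f x) ≤ (εA + εQ + εE) * (7 / 8) := by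
    rintro x ⟨hxK, hxH, hxW⟩
    obtain ⟨m, hm⟩ := mem_iUnion.1 hxH
    obtain ⟨n, hn, hxn⟩ := mem_iUnion₂.1 hxW
    have hcore : x ∈ D.core n := ⟨interior_subset hxn.1, hxK⟩
    have hwX : ∀ i < L, weightX D L i x = if i = n then 1 else 0 := fun i hi =>
      D.weightX_eq_ite hxn hn hLN hi
    have hchat : ∀ m', P.Chat L m' x ≤ εA / 4 ↔ m' = m := by
      intro m'
      have h1 : P.Chat L m' x =
          ∑ i, simplexProj (g n m' (enc.encode n (k' n m') x)) i * |z n m' i| := by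
        refine (Finset.sum_eq_single_of_mem n (Finset.mem_range.2 hn) fun i hi hin => ?_).trans ?_
        · rw [hwX i (Finset.mem_range.1 hi), if_neg hin, zero_mul]
        · rw [hwX n hn, if_pos rfl, one_mul]
      rw [h1, (hclass n m' hn).2.2.2.2 x hcore m hm]
      exact eq_comm
    have hwY : ∀ m', P.weightY L εA m' x = if m' = m then 1 else 0 := by
      intro m'
      simp [ModelParams.weightY, hchat]
    obtain ⟨h1, h2⟩ := (hmap n m hn).2.2.2.2 x hcore (hEpart m hm)
    exact ⟨n, m, hn, hwX, hwY, h1, h2⟩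
  have hMne : Nonempty (Fin M) := by
    obtain ⟨x⟩ := μ.nonempty_of_neZero
    obtain ⟨m, -⟩ := mem_iUnion.1 (hpart.cover.symm ▸ mem_univ (f x) : f x ∈ ⋃ m, part m)
    exact ⟨m⟩
  choose! nx mx hnx hwX hwY hloc hdist using hGpt
  have hεpos : (0 : ℝ) < εA + εQ + εE := by positivity
  refine ⟨P, fun x => diracP1 (P.localMap (nx x) (mx x) x), fun n hn m => ?_, fun n hn m hne => ?_,
    ?_, fun x hx => ?_, fun x hx => ?_⟩
  · obtain ⟨h1, h2, h3, -⟩ := hmap n m hn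
    obtain ⟨h1', h2', h3', -⟩ := hclass n m hn
    exact ⟨h1, h2, h1', h2', h3, h3'⟩
  · obtain ⟨-, -, -, h, -⟩ := hmap n m hn
    obtain ⟨-, -, -, h', -⟩ := hclass n m hn
    exact ⟨(h hne).1, h' hne, (h hne).2⟩
  · have hle : (⨆ x ∈ G, W1 (diracP1 (P.localMap (nx x) (mx x) x)) (diracP1 (f x))) ≤
        ENNReal.ofReal ((εA + εQ + εE) * (7 / 8)) := by
      refine iSup₂_le fun x hx => (W1_diracP1_le _ _).trans ?_
      rw [edist_dist]
      exact ENNReal.ofReal_le_ofReal (hdist x hx)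
    refine hle.trans_lt ?_
    rw [← ENNReal.ofReal_coe_nnreal]
    push_cast
    exact (ENNReal.ofReal_lt_ofReal_iff hεpos).2 (by linarith)
  · have hsum : ∀ n ∈ Finset.range L, ∑ m, ENNReal.ofReal (weightX D L n x * P.weightY L εA m x) •
        Measure.dirac (P.localMap n m x) =
        if n = nx x then Measure.dirac (P.localMap n (mx x) x) else 0 := by
      intro n hn
      rw [Finset.sum_eq_single_of_mem (mx x) (Finset.mem_univ _) fun m _ hm => by
        rw [hwY x hx, if_neg hm, mul_zero, ENNReal.ofReal_zero, zero_smul]]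
      rw [hwX x hx n (Finset.mem_range.1 hn), hwY x hx, if_pos rfl, mul_one]
      split_ifs
      · rw [ENNReal.ofReal_one, one_smul]
      · rw [ENNReal.ofReal_zero, zero_smul]
    rw [Finset.sum_congr rfl hsum, Finset.sum_ite_eq' , if_pos (Finset.mem_range.2 (hnx x hx))]
    rfl
  · refine ⟨mx x, by rw [hwY x hx, if_pos rfl], diracP1 ⟨_, hloc x hx⟩,
      Measure.map_dirac' measurable_subtype_coe _, fun β hβ => ?_⟩
    -- The measure is a point mass in the part, so the left-inverse property evaluates `β` exactly.
    rw [hβ.1]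
    exact (hdist x hx).trans_lt (by linarith)
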